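/- Let $m,n\ge 1$, let $\theta$ be a permutation of $\{1,\dots,m\}\times\{1,\dots,n\}$, and let $\mathbb{F}_\theta^+$ be the unital semigroup with generators $e_1,\dots,e_m,f_1,\dots,f_n$ and relations $e_if_j=f_{j'}e_{i'}$ where $\theta(i,j)=(i',j')$. Let $K\le\mathbb{Z}^2$ be a subgroup, $G=\mathbb{Z}^2/K$, and let $\mathfrak g_1,\mathfrak g_2$ be the images of $(1,0),(0,1)$ in $G$. A group construction representation $\sigma$ of $\mathbb{F}_\theta^+$ on $\ell^2(G)$ is given by functions $i:G\to\{1,\dots,m\}$, $j:G\to\{1,\dots,n\}$, $\alpha,\beta:G\to\mathbb{T}$ with $e_{i(g+\mathfrak g_2)}f_{j(g)}=f_{j(g+\mathfrak g_1)}e_{i(g)}$ and $\alpha(g+\mathfrak g_2)\beta(g)=\beta(g+\mathfrak g_1)\alpha(g)$ for all $g\in G$, through $$\sigma(e_a)\xi_g=\delta_{a,i(g)}\,\alpha(g)\,\xi_{g+\mathfrak g_1},\qquad \sigma(f_b)\xi_g=\delta_{b,j(g)}\,\beta(g)\,\xi_{g+\mathfrak g_2}.$$ Its character $\psi\in\hat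 K$ is defined as follows: for $(s,t)\in K$, following $s$ blue edges ($\xi_g\mapsto\alpha(g)\xi_{g+\mathfrak g_1}$) and then $t$ red edges ($\xi_g\mapsto\beta(g)\xi_{g+\mathfrak g_2}$), backwards if the number is negative, takes $\xi_0$ to $\psi(s,t)\xi_0$. Its symmetry group is $H=\{h\in G: i(g+h)=i(g),\ j(g+h)=j(g)\ \text{for all } g\in G\}$. Let $L=HK$ be the preimage of $H$ in $\mathbb{Z}^2$, so that $G/H=\mathbb{Z}^2/L$. Then there are group construction representations $\sigma_\chi$ of $\mathbb{F}_\theta^+$ on $\ell^2(G/H)$, one for each $\chi\in\hat H$, such that: 1. each $\sigma_\chi$ is irreducible and atomic; 2. the $\sigma_\chi$ all have the same graph, with labels $i_{[g]}=i(g)$ and $j_{[g]}=j(g)$; 3. the map that sends $\chi$ to the character $\psi_\chi\in\hat L$ of $\sigma_\chi$ is a bijection of $\hat H$ onto the set of all extensions of $\psi$ from $K$ to $L$, and $\psi_\chi(l)=\psi_{1}(l)\,\chi(l+K)$ for $l\in L$, where $1\in\hat H$ is the trivial character; 4. if $H$ is finite, then $\hat H$ is finite and $\sigma$ is unitarily equivalent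 to the direct sum $\bigoplus_{\chi\in\hat H}\sigma_\chi$; 5. if $H$ is infinite, then $\chi\mapsto\sigma_\chi$ is a measurable field of representations and $\sigma$ is unitarily equivalent to the direct integral $\int^{\oplus}_{\hat H}\sigma_\chi\,d\mu(\chi)$ on $L^2(\hat H,\mu;\ell^2(G/H))$, where $\mu$ is the normalized Haar measure on $\hat H$. -/

import Mathlib

open scoped ENNReal
open MeasureTheory

noncomputable section

/-! ### The semigroup and its representations -/

/-- The commutation relations `e_i f_j = f_{j'} e_{i'}`, where `θ (i, j) = (i', j')`; the letter
`Sum.inl i` stands for `e_i` and `Sum.inr j` for `f_j`. -/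
inductive CommRel {m n : ℕ} (θ : Equiv.Perm (Fin m × Fin n)) :
    FreeMonoid (Fin m ⊕ Fin n) → FreeMonoid (Fin m ⊕ Fin n) → Prop
  | comm (i : Fin m) (j : Fin n) :
      CommRel θ (FreeMonoid.of (Sum.inl i) * FreeMonoid.of (Sum.inr j))
        (FreeMonoid.of (Sum.inr (θ (i, j)).2) * FreeMonoid.of (Sum.inl (θ (i, j)).1))

/-- The unital semigroup `𝔽_θ⁺`. -/
abbrev FTheta {m n : ℕ} (θ : Equiv.Perm (Fin m × Fin n)) : Type := PresentedMonoid (CommRel θ)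

/-- The generator `e_i` of `𝔽_θ⁺`. -/
def FTheta.e {m n : ℕ} (θ : Equiv.Perm (Fin m × Fin n)) (i : Fin m) : FTheta θ :=
  PresentedMonoid.of (CommRel θ) (Sum.inl i)

/-- The generator `f_j` of `𝔽_θ⁺`. -/
def FTheta.f {m n : ℕ} (θ : Equiv.Perm (Fin m × Fin n)) (j : Fin n) : FTheta θ :=
  PresentedMonoid.of (CommRel θ) (Sum.inr j)

/-- A representation is atomic if every `σ(w)` is a partial isometry and some orthonormal basis is
permuted, up to scalars in `𝕋 ∪ {0}`, by every `σ(w)`. -/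
def IsAtomicRep {S : Type} [Monoid S] {E : Type} [NormedAddCommGroup E] [InnerProductSpace ℂ E]
    [CompleteSpace E] (σ : S →* (E →L[ℂ] E)) : Prop :=
  (∀ w, σ w * ContinuousLinearMap.adjoint (σ w) * σ w = σ w) ∧
  ∃ (ι : Type) (b : HilbertBasis ι ℂ E), ∀ w k, ∃ (l : ι) (c : ℂ),
    (c = 0 ∨ ‖c‖ = 1) ∧ σ w (b k) = c • b l

/-- A representation on a nonzero Hilbert space is irreducible if it has no closed reducing
subspaces except the two trivial ones. -/
def IsIrreducibleRep {S : Type} [Monoid S] {E : Type} [NormedAddCommGroup E]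
    [InnerProductSpace ℂ E] [CompleteSpace E] (σ : S →* (E →L[ℂ] E)) : Prop :=
  Nontrivial E ∧ ∀ M : Submodule ℂ E, IsClosed (M : Set E) →
    (∀ w, ∀ x ∈ M, σ w x ∈ M ∧ ContinuousLinearMap.adjoint (σ w) x ∈ M) → M = ⊥ ∨ M = ⊤

/-- `σ` is unitarily equivalent to the Hilbert space direct sum of the representations `τ k`. -/
def IsDirectSumRep {S : Type} [Monoid S] {E : Type} [NormedAddCommGroup E]
    [InnerProductSpace ℂ E] {ι : Type} {F : Type} [NormedAddCommGroup F]
    [InnerProductSpace ℂ F] (σ : S →* (E →L[ℂ] E)) (τ : ι → (S →* (F →L[ℂ] F))) : Prop :=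
  ∃ U : E ≃ₗᵢ[ℂ] lp (fun _ : ι => F) 2, ∀ w x k, U (σ w x) k = τ k w (U x k)

/-- `σ` is unitarily equivalent to the direct integral, over `(Ω, μ)` and with the constant field
of Hilbert spaces `F`, of the measurable field of representations `τ ω`. The direct integral of
this field of Hilbert spaces is `L²(Ω, μ; F)`. -/
def IsDirectIntegralRep {S : Type} [Monoid S] {E : Type} [NormedAddCommGroup E]
    [InnerProductSpace ℂ E] {Ω : Type} [MeasurableSpace Ω] (μ : Measure Ω) {F : Type}
    [NormedAddCommGroup F] [InnerProductSpace ℂ F]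
    (σ : S →* (E →L[ℂ] E)) (τ : Ω → (S →* (F →L[ℂ] F))) : Prop :=
  (∀ w v, StronglyMeasurable fun ω => τ ω w v) ∧
  ∃ U : E ≃ₗᵢ[ℂ] Lp F 2 μ, ∀ w x, ∀ᵐ ω ∂μ, U (σ w x) ω = τ ω w (U x ω)

/-! ### Operators on `ℓ²` -/

/-- The Hilbert space `ℓ²(X)`. -/
abbrev EllTwo (X : Type) : Type := lp (fun _ : X => ℂ) 2

open Classical in
/-- The standard basis vector `ξ_x` of `ℓ²(X)`. -/
def xi {X : Type} (x : X) : EllTwo X := lp.single 2 x (1 : ℂ)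

theorem sum_shift_le {X : Type} (τ : Equiv.Perm X) (c : X → ℂ) (hc : ∀ x, ‖c x‖ ≤ 1)
    (v : EllTwo X) (s : Finset X) :
    ∑ x ∈ s, ‖c (τ.symm x) * v (τ.symm x)‖ ^ (2 : ℝ≥0∞).toReal ≤
      ‖v‖ ^ (2 : ℝ≥0∞).toReal := by
  classical
  calc ∑ x ∈ s, ‖c (τ.symm x) * v (τ.symm x)‖ ^ (2 : ℝ≥0∞).toReal
      ≤ ∑ x ∈ s, ‖v (τ.symm x)‖ ^ (2 : ℝ≥0∞).toReal := by
        refine Finset.sum_le_sum fun x _ => ?_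
        refine Real.rpow_le_rpow (norm_nonneg _) ?_ (by norm_num)
        rw [norm_mul]
        exact mul_le_of_le_one_left (norm_nonneg _) (hc _)
    _ = ∑ y ∈ s.map τ.symm.toEmbedding, ‖v y‖ ^ (2 : ℝ≥0∞).toReal := by
        rw [Finset.sum_map]; rfl
    _ ≤ ‖v‖ ^ (2 : ℝ≥0∞).toReal := lp.sum_rpow_le_norm_rpow (by norm_num) v _

/-- The operator on `ℓ²(X)` with `ξ_x ↦ c_x ξ_{τ x}`. -/
def weightedShift {X : Type} (τ : Equiv.Perm X) (c : X → ℂ) (hc : ∀ x, ‖c x‖ ≤ 1) :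
    EllTwo X →L[ℂ] EllTwo X :=
  LinearMap.mkContinuous
    { toFun := fun v => ⟨fun x => c (τ.symm x) * v (τ.symm x),
        memℓp_gen' (sum_shift_le τ c hc v)⟩
      map_add' := fun v w => lp.ext (funext fun x => mul_add _ _ _)
      map_smul' := fun a v => lp.ext (funext fun x => mul_left_comm _ _ _) }
    1 (fun v => by
      rw [one_mul]
      exact lp.norm_le_of_forall_sum_le (by norm_num) (norm_nonneg v) (sum_shift_le τ c hc v))

theorem weightedShift_apply {X : Type} (τ : Equiv.Perm X) (c : X → ℂ) (hc : ∀ x, ‖c x‖ ≤ 1)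
    (v : EllTwo X) (x : X) :
    weightedShift τ c hc v x = c (τ.symm x) * v (τ.symm x) := rfl

theorem weightedShift_xi {X : Type} (τ : Equiv.Perm X) (c : X → ℂ) (hc : ∀ x, ‖c x‖ ≤ 1)
    (x : X) : weightedShift τ c hc (xi x) = c x • xi (τ x) := by
  classical
  refine lp.ext (funext fun y => ?_)
  rw [weightedShift_apply, lp.coeFn_smul, Pi.smul_apply, smul_eq_mul, xi, xi,
    lp.single_apply, lp.single_apply, Pi.single_apply, Pi.single_apply]
  by_cases h : y = τ x
  · subst h; simp
  · have h' : τ.symm y ≠ x := fun e => h (by rw [← e]; simp)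
    simp [h, h']

/-- The graph of an atomic representation on `ℓ²(X)` with respect to the standard basis: its
vertices are the lines `ℂ ξ_x`; there is a blue edge with label `i` from `x` to `y` when
`σ(e_i)` maps `ℂ ξ_x` onto `ℂ ξ_y`, and a red edge with label `j` when `σ(f_j)` does. -/
def atomicGraph {m n : ℕ} {θ : Equiv.Perm (Fin m × Fin n)} {X : Type}
    (σ : FTheta θ →* (EllTwo X →L[ℂ] EllTwo X)) :
    (Fin m → X → X → Prop) × (Fin n → X → X → Prop) :=
  (fun i x y => ∃ c : ℂ, c ≠ 0 ∧ σ (FTheta.e θ i) (xi x) = c • xi y,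
   fun j x y => ∃ c : ℂ, c ≠ 0 ∧ σ (FTheta.f θ j) (xi x) = c • xi y)

/-! ### Group constructions on `G = ℤ² / K` -/

/-- The first designated generator of `ℤ² / K`. -/
def gOne (K : AddSubgroup (ℤ × ℤ)) : (ℤ × ℤ) ⧸ K := QuotientAddGroup.mk (1, 0)

/-- The second designated generator of `ℤ² / K`. -/
def gTwo (K : AddSubgroup (ℤ × ℤ)) : (ℤ × ℤ) ⧸ K := QuotientAddGroup.mk (0, 1)

/-- The data of a group construction representation of `𝔽_θ⁺` on `G = ℤ² / K`. The condition
`comm_label` says that `e_{i(g + g₂)} f_{j(g)} = f_{j(g + g₁)} e_{i(g)}` is one of the commutation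
relations of `𝔽_θ⁺`. -/
structure GroupConstruction {m n : ℕ} (θ : Equiv.Perm (Fin m × Fin n))
    (K : AddSubgroup (ℤ × ℤ)) where
  i : (ℤ × ℤ) ⧸ K → Fin m
  j : (ℤ × ℤ) ⧸ K → Fin n
  α : (ℤ × ℤ) ⧸ K → Circle
  β : (ℤ × ℤ) ⧸ K → Circle
  comm_label : ∀ g, θ (i (g + gTwo K), j g) = (i g, j (g + gOne K))
  comm_scalar : ∀ g, α (g + gTwo K) * β g = β (g + gOne K) * α g

namespace GroupConstruction

variable {m n : ℕ} {θ : Equiv.Perm (Fin m × Fin n)} {K : AddSubgroup (ℤ × ℤ)}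

/-- `σ(e_a) ξ_g = δ_{a, i(g)} α(g) ξ_{g + g₁}`. -/
def opE (D : GroupConstruction θ K) (a : Fin m) :
    EllTwo ((ℤ × ℤ) ⧸ K) →L[ℂ] EllTwo ((ℤ × ℤ) ⧸ K) :=
  weightedShift (Equiv.addRight (gOne K)) (fun g => if a = D.i g then (D.α g : ℂ) else 0)
    (fun g => by
      split_ifs
      · exact (Circle.norm_coe _).le
      · simp)

/-- `σ(f_b) ξ_g = δ_{b, j(g)} β(g) ξ_{g + g₂}`. -/
def opF (D : GroupConstruction θ K) (b : Fin n) :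
    EllTwo ((ℤ × ℤ) ⧸ K) →L[ℂ] EllTwo ((ℤ × ℤ) ⧸ K) :=
  weightedShift (Equiv.addRight (gTwo K)) (fun g => if b = D.j g then (D.β g : ℂ) else 0)
    (fun g => by
      split_ifs
      · exact (Circle.norm_coe _).le
      · simp)

theorem opE_mul_opF (D : GroupConstruction θ K) (a : Fin m) (b : Fin n) :
    D.opE a * D.opF b = D.opF (θ (a, b)).2 * D.opE (θ (a, b)).1 := by
  refine ContinuousLinearMap.ext fun v => lp.ext (funext fun y => ?_)
  obtain ⟨g, rfl⟩ : ∃ g, y = g + gTwo K + gOne K := ⟨y - gOne K - gTwo K, by abel⟩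
  have e1 : g + gTwo K + gOne K - gOne K = g + gTwo K := by abel
  have e2 : g + gTwo K + gOne K - gTwo K = g + gOne K := by abel
  have hL := D.comm_label g
  have hS : (D.α (g + gTwo K) : ℂ) * D.β g = D.β (g + gOne K) * D.α g := by
    exact_mod_cast congrArg Subtype.val (D.comm_scalar g)
  have key : (a = D.i (g + gTwo K) ∧ b = D.j g) ↔
      ((θ (a, b)).2 = D.j (g + gOne K) ∧ (θ (a, b)).1 = D.i g) := by
    constructor
    · rintro ⟨rfl, rfl⟩
      rw [hL]; exact ⟨rfl, rfl⟩
    · rintro ⟨h2, h1⟩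
      have : θ (a, b) = θ (D.i (g + gTwo K), D.j g) := by
        rw [hL]; exact Prod.ext h1 h2
      have := θ.injective this
      exact ⟨congrArg Prod.fst this, congrArg Prod.snd this⟩
  change (if a = D.i (g + gTwo K + gOne K + -gOne K) then
      (D.α (g + gTwo K + gOne K + -gOne K) : ℂ) else 0) *
      ((if b = D.j (g + gTwo K + gOne K + -gOne K + -gTwo K) then
        (D.β (g + gTwo K + gOne K + -gOne K + -gTwo K) : ℂ) else 0) *
        v (g + gTwo K + gOne K + -gOne K + -gTwo K)) =
    (if (θ (a, b)).2 = D.j (g + gTwo K + gOne K + -gTwo K) then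
      (D.β (g + gTwo K + gOne K + -gTwo K) : ℂ) else 0) *
      ((if (θ (a, b)).1 = D.i (g + gTwo K + gOne K + -gTwo K + -gOne K) then
        (D.α (g + gTwo K + gOne K + -gTwo K + -gOne K) : ℂ) else 0) *
        v (g + gTwo K + gOne K + -gTwo K + -gOne K))
  simp only [← sub_eq_add_neg, e1, e2, add_sub_cancel_right]
  rw [← mul_assoc, ← mul_assoc, ite_zero_mul_ite_zero, ite_zero_mul_ite_zero, hS]
  simp only [key]

/-- The group construction representation `σ` of `𝔽_θ⁺` on `ℓ²(G)`. -/
def rep (D : GroupConstruction θ K) :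
    FTheta θ →* (EllTwo ((ℤ × ℤ) ⧸ K) →L[ℂ] EllTwo ((ℤ × ℤ) ⧸ K)) :=
  PresentedMonoid.lift (Sum.elim D.opE D.opF) (by
    rintro _ _ ⟨a, b⟩
    simpa using D.opE_mul_opF a b)

theorem rep_e_xi (D : GroupConstruction θ K) (a : Fin m) (g : (ℤ × ℤ) ⧸ K) :
    D.rep (FTheta.e θ a) (xi g) = (if a = D.i g then (D.α g : ℂ) else 0) • xi (g + gOne K) := by
  change D.opE a (xi g) = _
  exact weightedShift_xi _ _ _ g

theorem rep_f_xi (D : GroupConstruction θ K) (b : Fin n) (g : (ℤ × ℤ) ⧸ K) :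
    D.rep (FTheta.f θ b) (xi g) = (if b = D.j g then (D.β g : ℂ) else 0) • xi (g + gTwo K) := by
  change D.opF b (xi g) = _
  exact weightedShift_xi _ _ _ g

/-- The symmetry group `H` of a group construction. -/
def symmetryGroup (D : GroupConstruction θ K) : AddSubgroup ((ℤ × ℤ) ⧸ K) where
  carrier := {h | ∀ g, D.i (g + h) = D.i g ∧ D.j (g + h) = D.j g}
  zero_mem' := fun g => by simp
  add_mem' := fun {a b} ha hb g => by
    rw [← add_assoc]
    exact ⟨(hb _).1.trans (ha g).1, (hb _).2.trans (ha g).2⟩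
  neg_mem' := fun {a} ha g => by
    have := ha (g + -a)
    rw [neg_add_cancel_right] at this
    exact ⟨this.1.symm, this.2.symm⟩

/-- The subgroup `L = HK` of `ℤ²`, that is, the preimage of `H`, so that `G / H = ℤ² / L`. -/
def symmetryLift (D : GroupConstruction θ K) : AddSubgroup (ℤ × ℤ) :=
  D.symmetryGroup.comap (QuotientAddGroup.mk' K)

theorem le_symmetryLift (D : GroupConstruction θ K) : K ≤ D.symmetryLift := fun k hk => by
  have : QuotientAddGroup.mk' K k = 0 := (QuotientAddGroup.eq_zero_iff k).2 hk
  change QuotientAddGroup.mk' K k ∈ D.symmetryGroup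
  rw [this]
  exact zero_mem _

/-- The quotient map from `L` onto `H = L / K`. -/
def toSymmetry (D : GroupConstruction θ K) (l : D.symmetryLift) : D.symmetryGroup :=
  ⟨QuotientAddGroup.mk (l : ℤ × ℤ), l.2⟩

/-- The dual group `Ĥ` of the (discrete) symmetry group. -/
abbrev SymmetryDual (D : GroupConstruction θ K) : Type :=
  PontryaginDual (Multiplicative D.symmetryGroup)

/-- The Borel sets of `Ĥ`. -/
instance (D : GroupConstruction θ K) : MeasurableSpace D.SymmetryDual := borel _

/-! #### The character of `K` given by the scalars -/

/-- Following a blue edge: the vector `z ξ_g` is sent to `z α(g) ξ_{g + g₁}`. Such vectors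
are recorded as pairs `(g, z)`. The inverse follows the edge backwards. -/
def blueStep (D : GroupConstruction θ K) : Equiv.Perm (((ℤ × ℤ) ⧸ K) × Circle) where
  toFun p := (p.1 + gOne K, D.α p.1 * p.2)
  invFun p := (p.1 - gOne K, (D.α (p.1 - gOne K))⁻¹ * p.2)
  left_inv p := by simp
  right_inv p := by simp

/-- Following a red edge: the vector `z ξ_g` is sent to `z β(g) ξ_{g + g₂}`. -/
def redStep (D : GroupConstruction θ K) : Equiv.Perm (((ℤ × ℤ) ⧸ K) × Circle) where
  toFun p := (p.1 + gTwo K, D.β p.1 * p.2)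
  invFun p := (p.1 - gTwo K, (D.β (p.1 - gTwo K))⁻¹ * p.2)
  left_inv p := by simp
  right_inv p := by simp

theorem commute_steps (D : GroupConstruction θ K) : Commute D.redStep D.blueStep := by
  refine Equiv.ext fun p => ?_
  refine Prod.ext (add_right_comm _ _ _) ?_
  change D.β (p.1 + gOne K) * (D.α p.1 * p.2) = D.α (p.1 + gTwo K) * (D.β p.1 * p.2)
  rw [← mul_assoc, ← mul_assoc, D.comm_scalar]

/-- The path with `s` blue edges followed by `t` red edges (a negative number of edges means that
they are followed backwards). -/
def path (D : GroupConstruction θ K) (x : ℤ × ℤ) : Equiv.Perm (((ℤ × ℤ) ⧸ K) × Circle) :=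
  D.redStep ^ x.2 * D.blueStep ^ x.1

theorem path_add (D : GroupConstruction θ K) (x y : ℤ × ℤ) :
    D.path (x + y) = D.path x * D.path y := by
  have h : Commute (D.blueStep ^ x.1) (D.redStep ^ y.2) :=
    (D.commute_steps.symm.zpow_left _).zpow_right _
  simp only [path, Prod.fst_add, Prod.snd_add, zpow_add]
  rw [mul_assoc, mul_assoc, ← mul_assoc (D.redStep ^ y.2), ← mul_assoc (D.blueStep ^ x.1), h.eq]

/-- The steps commute with multiplying the vector by a scalar. -/
def scale (K : AddSubgroup (ℤ × ℤ)) (w : Circle) : Equiv.Perm (((ℤ × ℤ) ⧸ K) × Circle) :=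
  Equiv.prodCongr (Equiv.refl _) (Equiv.mulRight w)

theorem path_scale (D : GroupConstruction θ K) (x : ℤ × ℤ) (w : Circle)
    (p : ((ℤ × ℤ) ⧸ K) × Circle) :
    D.path x (p.1, p.2 * w) = ((D.path x p).1, (D.path x p).2 * w) := by
  have hb : Commute D.blueStep (scale K w) :=
    Equiv.ext fun p => Prod.ext rfl (mul_assoc _ _ _).symm
  have hr : Commute D.redStep (scale K w) :=
    Equiv.ext fun p => Prod.ext rfl (mul_assoc _ _ _).symm
  have h : Commute (D.path x) (scale K w) := (hr.zpow_left _).mul_left (hb.zpow_left _)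
  exact congrArg (fun e : Equiv.Perm _ => e p) h.eq

theorem path_fst (D : GroupConstruction θ K) (x : ℤ × ℤ) (p : ((ℤ × ℤ) ⧸ K) × Circle) :
    (D.path x p).1 = p.1 + QuotientAddGroup.mk x := by
  have hb : ∀ (s : ℤ) (p : ((ℤ × ℤ) ⧸ K) × Circle),
      ((D.blueStep ^ s) p).1 = p.1 + s • gOne K := by
    intro s
    induction s using Int.induction_on with
    | zero => intro p; simp
    | succ k ih =>
      intro p
      rw [zpow_add_one, Equiv.Perm.mul_apply, ih, add_zsmul, one_zsmul]
      change p.1 + gOne K + _ = _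
      abel
    | pred k ih =>
      intro p
      rw [zpow_sub_one, Equiv.Perm.mul_apply, ih, sub_zsmul, one_zsmul]
      change p.1 - gOne K + _ = _
      abel
  have hr : ∀ (s : ℤ) (p : ((ℤ × ℤ) ⧸ K) × Circle),
      ((D.redStep ^ s) p).1 = p.1 + s • gTwo K := by
    intro s
    induction s using Int.induction_on with
    | zero => intro p; simp
    | succ k ih =>
      intro p
      rw [zpow_add_one, Equiv.Perm.mul_apply, ih, add_zsmul, one_zsmul]
      change p.1 + gTwo K + _ = _
      abel
    | pred k ih =>
      intro p
      rw [zpow_sub_one, Equiv.Perm.mul_apply, ih, sub_zsmul, one_zsmul]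
      change p.1 - gTwo K + _ = _
      abel
  have hx : (QuotientAddGroup.mk x : (ℤ × ℤ) ⧸ K) = x.1 • gOne K + x.2 • gTwo K := by
    have : x = x.1 • ((1, 0) : ℤ × ℤ) + x.2 • ((0, 1) : ℤ × ℤ) := by ext <;> simp
    conv_lhs => rw [this]
    rfl
  rw [path, Equiv.Perm.mul_apply, hr, hb, hx, add_assoc]

/-- The character `ψ` of `K` given by the scalars: for `k = (s, t) ∈ K`, the path with `s` blue
and `t` red edges that starts at `ξ_0` returns to `ψ(k) ξ_0`. -/
def character (D : GroupConstruction θ K) : AddChar K Circle where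
  toFun k := (D.path k (0, 1)).2
  map_zero_eq_one' := by simp [path]
  map_add_eq_mul' k l := by
    have hk : (D.path (l : ℤ × ℤ) (0, 1)).1 = 0 := by
      rw [path_fst, (QuotientAddGroup.eq_zero_iff (l : ℤ × ℤ)).2 l.2, add_zero]
    have h := D.path_scale (k : ℤ × ℤ) (D.path (l : ℤ × ℤ) (0, 1)).2 (0, 1)
    rw [AddSubgroup.coe_add, path_add, Equiv.Perm.mul_apply]
    rw [one_mul] at h
    rw [show D.path (l : ℤ × ℤ) (0, 1) = (0, (D.path (l : ℤ × ℤ) (0, 1)).2) from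
      Prod.ext hk rfl]
    exact congrArg Prod.snd h

end GroupConstruction

end

noncomputable section

/-! ### Sections of `ℤ² → ℤ² / L` -/

/-! Fix a section `r` of `ℤ² → ℤ²/L` and put `d(x) = x - r([x]) ∈ L` (`sectionDefect`). For a
character `ω` of `L`, the numbers `ω(d(r(y) + (1,0)))` and `ω(d(r(y) + (0,1)))` serve as edge
scalars on `G/H`: the cocycle identity `sectionDefect_add` shows that they are compatible and that
the resulting construction `quotientBy` has character `ω`. Since the circle is divisible, `ψ`
extends to some `ω₀` on `L`. The extensions of `ψ` are then exactly `ω_χ = ω₀ · (χ inflated to L)`,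
and `σ_χ` is the construction for `ω_χ`.

Irreducibility: passing to `G/H` kills all symmetries. If `T` commutes with such a representation, a
nonzero matrix entry at `(x, y)` persists under simultaneous translation and forces equal labels, so
`y - x` is a symmetry and hence `0`. The diagonal entries are constant. Thus `T` is a scalar
(`eq_smul_one_of_commute`), in particular every projection onto a reducing subspace.

Decomposition: as a set, `G` is `G/H × H`. With `s(x)` the scalar of the path from the origin to
`x`, send `ξ_[x]` to the field `χ ↦ s(x)⁻¹ ω_χ(d(x)) ξ_[x]` (`integralField`). It does not depend on
the lift `x`, because `ω_χ` extends `ψ`. These fields form an orthonormal basis of `L²(Ĥ; ℓ²(G/H))`,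
by orthogonality and completeness of the characters of `Ĥ` (`vectorFieldBasis`), and each generator
acts on them with the coefficients of `σ`. For finite `H`, rescaling by square roots of point masses
turns the integral into a sum. -/

theorem int_prod_induction {P : ℤ × ℤ → Prop} (h0 : P 0) (h1 : ∀ x, P (x + (1, 0)) ↔ P x)
    (h2 : ∀ x, P (x + (0, 1)) ↔ P x) (x : ℤ × ℤ) : P x := by
  -- Because the step is an equivalence, it also runs backwards and covers negative multiples of
  -- `e`.
  have key : ∀ e : ℤ × ℤ, (∀ x, P (x + e) ↔ P x) → ∀ (s : ℤ) (x), P (x + s • e) ↔ P x := by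
    intro e he s
    induction s using Int.induction_on with
    | zero => simp
    | succ k ih => intro x; rw [add_zsmul, one_zsmul, ← add_assoc, he, ih]
    | pred k ih =>
      intro x
      rw [← he, sub_zsmul, one_zsmul, add_assoc, neg_add_cancel_right, ih]
  have hx : x = 0 + x.1 • ((1, 0) : ℤ × ℤ) + x.2 • ((0, 1) : ℤ × ℤ) := by ext <;> simp
  rw [hx, key _ h2, key _ h1]
  exact h0

/-- A representative in `ℤ²` of a class modulo `L`. -/
def quotientSection (L : AddSubgroup (ℤ × ℤ)) (y : (ℤ × ℤ) ⧸ L) : ℤ × ℤ := Quotient.out y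

@[simp]
theorem mk_quotientSection (L : AddSubgroup (ℤ × ℤ)) (y : (ℤ × ℤ) ⧸ L) :
    (QuotientAddGroup.mk (quotientSection L y) : (ℤ × ℤ) ⧸ L) = y := QuotientAddGroup.out_eq' y

/-- The difference between an element of `ℤ²` and the representative of its class modulo `L`. -/
def sectionDefect (L : AddSubgroup (ℤ × ℤ)) (x : ℤ × ℤ) : L :=
  ⟨x - quotientSection L (QuotientAddGroup.mk x), by
    rw [← QuotientAddGroup.eq_zero_iff, QuotientAddGroup.mk_sub, mk_quotientSection, sub_self]⟩

/-- A cocycle identity: the first summand on the right depends on `x` only through its class.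
Composed with a character of `L`, the defect therefore has increments that are functions on `ℤ²/L`,
as edge scalars must be. -/
theorem sectionDefect_add (L : AddSubgroup (ℤ × ℤ)) (x e : ℤ × ℤ) :
    sectionDefect L (x + e) = sectionDefect L (quotientSection L (QuotientAddGroup.mk x) + e) +
      sectionDefect L x := by
  refine Subtype.ext ?_
  simp only [sectionDefect, AddSubgroup.coe_add, QuotientAddGroup.mk_add, mk_quotientSection]
  abel

theorem sectionDefect_add_coe (L : AddSubgroup (ℤ × ℤ)) (x : ℤ × ℤ) (l : L) :
    sectionDefect L (x + l) = sectionDefect L x + l := by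
  refine Subtype.ext ?_
  have : (QuotientAddGroup.mk (x + (l : ℤ × ℤ)) : (ℤ × ℤ) ⧸ L) = QuotientAddGroup.mk x := by
    rw [QuotientAddGroup.mk_add, (QuotientAddGroup.eq_zero_iff (l : ℤ × ℤ)).2 l.2, add_zero]
  simp only [sectionDefect, AddSubgroup.coe_add, this]
  abel

/-! ### Extending characters -/

theorem AddCircle.toCircle_surjective : Function.Surjective (@AddCircle.toCircle (1 : ℝ)) := by
  intro z
  refine ⟨(AddCircle.homeomorphCircle one_ne_zero).symm z, ?_⟩
  rw [← AddCircle.homeomorphCircle_apply one_ne_zero, Homeomorph.apply_symm_apply]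

/-- The circle, written additively, is `ℝ / ℤ`. -/
def circleAddEquiv : AddCircle (1 : ℝ) ≃+ Additive Circle :=
  AddEquiv.ofBijective
    ({ toFun := fun x => Additive.ofMul x.toCircle
       map_zero' := by simp
       map_add' := fun x y => by rw [AddCircle.toCircle_add]; rfl } :
      AddCircle (1 : ℝ) →+ Additive Circle)
    ⟨fun _ _ h => AddCircle.injective_toCircle one_ne_zero (Additive.ofMul.injective h),
      fun z => by
        obtain ⟨x, hx⟩ := AddCircle.toCircle_surjective z.toMul
        exact ⟨x, congrArg Additive.ofMul hx⟩⟩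

/-- Characters of a subgroup of an abelian group extend to the group. -/
theorem exists_addChar_extension {A B : Type} [AddCommGroup A] [AddCommGroup B] (f : A →+ B)
    (hf : Function.Injective f) (ψ : AddChar A Circle) :
    ∃ ψ' : AddChar B Circle, ∀ a, ψ' (f a) = ψ a := by
  -- The circle is divisible, hence an injective abelian group by Baer's criterion.
  obtain ⟨g, hg⟩ := (Module.Baer.of_divisible (AddCircle (1 : ℝ))).extension_property_addMonoidHom
    f hf (circleAddEquiv.symm.toAddMonoidHom.comp ψ.toAddMonoidHom)
  refine ⟨AddChar.toAddMonoidHomEquiv.symm (circleAddEquiv.toAddMonoidHom.comp g), fun a => ?_⟩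
  have : g (f a) = circleAddEquiv.symm (ψ.toAddMonoidHom a) := DFunLike.congr_fun hg a
  change (circleAddEquiv (g (f a))).toMul = ψ a
  rw [this, AddEquiv.apply_symm_apply]
  rfl

/-- Characters separate the points of an abelian group. -/
theorem exists_addChar_ne_one {A : Type} [AddCommGroup A] {a : A} (ha : a ≠ 0) :
    ∃ ψ : AddChar A Circle, ψ a ≠ 1 := by
  obtain ⟨c, hc⟩ := CharacterModule.exists_character_apply_ne_zero_of_ne_zero ha
  -- The separating character `c` takes values in `ℚ/ℤ`; the inclusion into `ℝ/ℤ` is injective, so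
  -- `c a` stays nonzero.
  let f : AddCircle (1 : ℚ) →+ AddCircle (1 : ℝ) :=
    QuotientAddGroup.map _ _ (Rat.castHom ℝ).toAddMonoidHom (by
      rintro _ ⟨k, rfl⟩
      exact ⟨k, by simp⟩)
  have hf : ∀ x, f x = 0 → x = 0 := by
    intro x
    induction x using QuotientAddGroup.induction_on with
    | H q =>
      intro h
      obtain ⟨k, hk⟩ := (QuotientAddGroup.eq_zero_iff (q : ℝ)).1 h
      refine (QuotientAddGroup.eq_zero_iff q).2 ⟨k, ?_⟩
      have : (k : ℝ) = (q : ℝ) := by simpa using hk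
      simpa using (by exact_mod_cast this : (k : ℚ) = q)
  refine ⟨AddChar.toAddMonoidHomEquiv.symm (circleAddEquiv.toAddMonoidHom.comp
    (f.comp c)), fun h => hc (hf _ ?_)⟩
  exact circleAddEquiv.injective ((show circleAddEquiv (f (c a)) = 0 from h).trans
    (map_zero _).symm)

namespace GroupConstruction

variable {m n : ℕ} {θ : Equiv.Perm (Fin m × Fin n)} {K : AddSubgroup (ℤ × ℤ)}

/-! ### Scalars along paths from the origin -/

/-- The scalar of the path from `ξ_0` with degree `x`. -/
def pathScalar (D : GroupConstruction θ K) (x : ℤ × ℤ) : Circle := (D.path x (0, 1)).2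

theorem path_origin (D : GroupConstruction θ K) (x : ℤ × ℤ) :
    D.path x (0, 1) = (QuotientAddGroup.mk x, D.pathScalar x) :=
  Prod.ext (by rw [path_fst, zero_add]) rfl

theorem pathScalar_zero (D : GroupConstruction θ K) : D.pathScalar 0 = 1 := by
  simp [pathScalar, path]

theorem pathScalar_add_one (D : GroupConstruction θ K) (x : ℤ × ℤ) :
    D.pathScalar (x + (1, 0)) = D.α (QuotientAddGroup.mk x) * D.pathScalar x := by
  rw [pathScalar, add_comm, path_add, Equiv.Perm.mul_apply, path_origin]
  simp [path, blueStep]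

theorem pathScalar_add_two (D : GroupConstruction θ K) (x : ℤ × ℤ) :
    D.pathScalar (x + (0, 1)) = D.β (QuotientAddGroup.mk x) * D.pathScalar x := by
  rw [pathScalar, add_comm, path_add, Equiv.Perm.mul_apply, path_origin]
  simp [path, redStep]

/-- The loop `k` is followed first. It returns to the origin with the scalar `ψ(k)`, which then
passes unchanged through the rest of the path. -/
theorem pathScalar_add_coe (D : GroupConstruction θ K) (x : ℤ × ℤ) (k : K) :
    D.pathScalar (x + k) = D.pathScalar x * D.character k := by
  rw [pathScalar, path_add, Equiv.Perm.mul_apply, path_origin,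
    (QuotientAddGroup.eq_zero_iff (k : ℤ × ℤ)).2 k.2]
  have h := D.path_scale x (D.pathScalar k) (0, 1)
  rw [one_mul] at h
  exact congrArg Prod.snd h

/-- The two recursions and the value at `0` determine the path scalars, so a closed formula for them
only has to be checked edge by edge. -/
theorem eq_pathScalar (D : GroupConstruction θ K) (F : ℤ × ℤ → Circle) (h0 : F 0 = 1)
    (h1 : ∀ x, F (x + (1, 0)) = D.α (QuotientAddGroup.mk x) * F x)
    (h2 : ∀ x, F (x + (0, 1)) = D.β (QuotientAddGroup.mk x) * F x) (x : ℤ × ℤ) :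
    D.pathScalar x = F x := by
  induction x using int_prod_induction with
  | h0 => rw [h0, pathScalar_zero]
  | h1 x => rw [h1, pathScalar_add_one, mul_right_inj]
  | h2 x => rw [h2, pathScalar_add_two, mul_right_inj]

/-! ### Group constructions on the quotient by the symmetry group -/

theorem i_add_coe (D : GroupConstruction θ K) (x : ℤ × ℤ) (l : D.symmetryLift) :
    D.i (QuotientAddGroup.mk (x + (l : ℤ × ℤ))) = D.i (QuotientAddGroup.mk x) :=
  (l.2 (QuotientAddGroup.mk x)).1

theorem j_add_coe (D : GroupConstruction θ K) (x : ℤ × ℤ) (l : D.symmetryLift) :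
    D.j (QuotientAddGroup.mk (x + (l : ℤ × ℤ))) = D.j (QuotientAddGroup.mk x) :=
  (l.2 (QuotientAddGroup.mk x)).2

theorem quotientSection_add_sectionDefect (L : AddSubgroup (ℤ × ℤ)) (x : ℤ × ℤ) :
    quotientSection L (QuotientAddGroup.mk x) + sectionDefect L x = x :=
  add_sub_cancel _ _

theorem i_quotientSection (D : GroupConstruction θ K) (x : ℤ × ℤ) :
    D.i (QuotientAddGroup.mk (quotientSection D.symmetryLift (QuotientAddGroup.mk x))) =
      D.i (QuotientAddGroup.mk x) := by
  conv_rhs => rw [← quotientSection_add_sectionDefect D.symmetryLift x]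
  rw [i_add_coe]

theorem j_quotientSection (D : GroupConstruction θ K) (x : ℤ × ℤ) :
    D.j (QuotientAddGroup.mk (quotientSection D.symmetryLift (QuotientAddGroup.mk x))) =
      D.j (QuotientAddGroup.mk x) := by
  conv_rhs => rw [← quotientSection_add_sectionDefect D.symmetryLift x]
  rw [j_add_coe]

theorem addChar_sectionDefect_add {L : AddSubgroup (ℤ × ℤ)} (ω : AddChar L Circle)
    (x e : ℤ × ℤ) : ω (sectionDefect L (x + e)) =
      ω (sectionDefect L (quotientSection L (QuotientAddGroup.mk x) + e)) *
        ω (sectionDefect L x) := by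
  rw [sectionDefect_add, AddChar.map_add_eq_mul]

/-- The group construction on `G / H` with the induced labels and with character `ω`. -/
def quotientBy (D : GroupConstruction θ K) (ω : AddChar D.symmetryLift Circle) :
    GroupConstruction θ D.symmetryLift where
  i y := D.i (QuotientAddGroup.mk (quotientSection _ y))
  j y := D.j (QuotientAddGroup.mk (quotientSection _ y))
  α y := ω (sectionDefect _ (quotientSection _ y + (1, 0)))
  β y := ω (sectionDefect _ (quotientSection _ y + (0, 1)))
  comm_label y := by
    obtain ⟨x, rfl⟩ := QuotientAddGroup.mk_surjective y
    have h1 : (QuotientAddGroup.mk x + gOne D.symmetryLift : (ℤ × ℤ) ⧸ D.symmetryLift) =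
      QuotientAddGroup.mk (x + (1, 0)) := rfl
    have h2 : (QuotientAddGroup.mk x + gTwo D.symmetryLift : (ℤ × ℤ) ⧸ D.symmetryLift) =
      QuotientAddGroup.mk (x + (0, 1)) := rfl
    simp only [h1, h2, i_quotientSection, j_quotientSection]
    exact D.comm_label (QuotientAddGroup.mk x)
  comm_scalar y := by
    obtain ⟨x, rfl⟩ := QuotientAddGroup.mk_surjective y
    have h1 : (QuotientAddGroup.mk x + gOne D.symmetryLift : (ℤ × ℤ) ⧸ D.symmetryLift) =
      QuotientAddGroup.mk (x + (1, 0)) := rfl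
    have h2 : (QuotientAddGroup.mk x + gTwo D.symmetryLift : (ℤ × ℤ) ⧸ D.symmetryLift) =
      QuotientAddGroup.mk (x + (0, 1)) := rfl
    -- After multiplication by `ω(d(x))`, two uses of the cocycle identity turn each side into
    -- `ω(d(x + (1,0) + (0,1)))`.
    refine mul_right_cancel (b := ω (sectionDefect _ x)) ?_
    rw [h1, h2, mul_assoc, mul_assoc, ← addChar_sectionDefect_add, ← addChar_sectionDefect_add,
      ← addChar_sectionDefect_add, ← addChar_sectionDefect_add, add_right_comm]

theorem quotientBy_i_mk (D : GroupConstruction θ K) (ω : AddChar D.symmetryLift Circle)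
    (x : ℤ × ℤ) : (D.quotientBy ω).i (QuotientAddGroup.mk x) = D.i (QuotientAddGroup.mk x) :=
  D.i_quotientSection x

theorem quotientBy_j_mk (D : GroupConstruction θ K) (ω : AddChar D.symmetryLift Circle)
    (x : ℤ × ℤ) : (D.quotientBy ω).j (QuotientAddGroup.mk x) = D.j (QuotientAddGroup.mk x) :=
  D.j_quotientSection x

/-- By the cocycle identity `x ↦ ω(d(x))` obeys the recursions of the path scalars, and `d(l) = d(0)
+ l` for `l ∈ L`. Division by `ω(d(0))` is needed because the section need not choose `0` in the
class of `0`. -/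
theorem quotientBy_character (D : GroupConstruction θ K) (ω : AddChar D.symmetryLift Circle) :
    (D.quotientBy ω).character = ω := by
  refine DFunLike.ext _ _ fun l => ?_
  have h := (D.quotientBy ω).eq_pathScalar
    (fun x => ω (sectionDefect _ x) * (ω (sectionDefect _ 0))⁻¹) (mul_inv_cancel _)
    (fun x => by rw [← mul_assoc]; exact congrArg (· * _) (addChar_sectionDefect_add ω x _))
    (fun x => by rw [← mul_assoc]; exact congrArg (· * _) (addChar_sectionDefect_add ω x _)) l
  change (D.quotientBy ω).pathScalar l = _
  rw [h]
  have h0 := sectionDefect_add_coe D.symmetryLift 0 l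
  rw [zero_add] at h0
  rw [h0, AddChar.map_add_eq_mul, mul_right_comm, mul_inv_cancel, one_mul]

/-- A lift to `ℤ²` of a symmetry of the induced labels is a symmetry of the original ones, so it
already lies in `L`. This is the input for irreducibility. -/
theorem quotientBy_symmetryGroup (D : GroupConstruction θ K)
    (ω : AddChar D.symmetryLift Circle) : (D.quotientBy ω).symmetryGroup = ⊥ := by
  refine (AddSubgroup.eq_bot_iff_forall _).2 fun h hh => ?_
  obtain ⟨x, rfl⟩ := QuotientAddGroup.mk_surjective h
  refine (QuotientAddGroup.eq_zero_iff x).2 fun g => ?_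
  obtain ⟨z, rfl⟩ := QuotientAddGroup.mk_surjective g
  have hz := hh (QuotientAddGroup.mk z)
  rw [← QuotientAddGroup.mk_add, quotientBy_i_mk, quotientBy_i_mk, quotientBy_j_mk,
    quotientBy_j_mk] at hz
  exact hz

/-! ### The characters of `L` that come from `H` -/

/-- The quotient map from `L` onto `H = L / K`, as a homomorphism. -/
def toSymmetryHom (D : GroupConstruction θ K) : D.symmetryLift →+ D.symmetryGroup where
  toFun := D.toSymmetry
  map_zero' := rfl
  map_add' _ _ := rfl

theorem toSymmetryHom_surjective (D : GroupConstruction θ K) :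
    Function.Surjective D.toSymmetryHom := by
  rintro ⟨h, hh⟩
  obtain ⟨x, rfl⟩ := QuotientAddGroup.mk_surjective h
  exact ⟨⟨x, hh⟩, rfl⟩

theorem toSymmetryHom_eq_zero_iff (D : GroupConstruction θ K) (l : D.symmetryLift) :
    D.toSymmetryHom l = 0 ↔ (l : ℤ × ℤ) ∈ K := by
  rw [← QuotientAddGroup.eq_zero_iff, ← Subtype.coe_inj]
  rfl

theorem discreteTopology_quotient (K : AddSubgroup (ℤ × ℤ)) :
    DiscreteTopology ((ℤ × ℤ) ⧸ K) :=
  QuotientAddGroup.discreteTopology_iff.2 (isOpen_discrete _)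

/-- Continuity is now automatic for characters of `H`, so `SymmetryDual` contains every algebraic
character. -/
instance (D : GroupConstruction θ K) : DiscreteTopology (Multiplicative D.symmetryGroup) := by
  have := discreteTopology_quotient K
  exact inferInstanceAs (DiscreteTopology D.symmetryGroup)

/-- A character of `H`, as an element of the dual group. -/
def dualOfAddChar (D : GroupConstruction θ K) (ψ : AddChar D.symmetryGroup Circle) :
    D.SymmetryDual :=
  (⟨ψ.toMonoidHom, continuous_of_discreteTopology⟩ : Multiplicative D.symmetryGroup →ₜ* Circle)

/-- The character of `L` obtained from a character of `H = L / K`. -/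
def inflate (D : GroupConstruction θ K) (χ : D.SymmetryDual) : AddChar D.symmetryLift Circle where
  toFun l := χ (Multiplicative.ofAdd (D.toSymmetryHom l))
  map_zero_eq_one' := by simp
  map_add_eq_mul' a b := by simp

theorem inflate_apply (D : GroupConstruction θ K) (χ : D.SymmetryDual) (l : D.symmetryLift) :
    D.inflate χ l = χ (Multiplicative.ofAdd (D.toSymmetryHom l)) := rfl

/-- A character of `L` that extends the character of `D`. -/
def extendedCharacter (D : GroupConstruction θ K) : AddChar D.symmetryLift Circle :=
  (exists_addChar_extension (AddSubgroup.inclusion D.le_symmetryLift)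
    (AddSubgroup.inclusion_injective _) D.character).choose

theorem extendedCharacter_inclusion (D : GroupConstruction θ K) (k : K) :
    D.extendedCharacter (AddSubgroup.inclusion D.le_symmetryLift k) = D.character k :=
  (exists_addChar_extension (AddSubgroup.inclusion D.le_symmetryLift)
    (AddSubgroup.inclusion_injective _) D.character).choose_spec k

/-- The group construction `σ_χ` on `G / H`. -/
def component (D : GroupConstruction θ K) (χ : D.SymmetryDual) :
    GroupConstruction θ D.symmetryLift :=
  D.quotientBy (D.extendedCharacter * D.inflate χ)

theorem component_character (D : GroupConstruction θ K) (χ : D.SymmetryDual) :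
    (D.component χ).character = D.extendedCharacter * D.inflate χ :=
  D.quotientBy_character _

theorem inflate_inclusion (D : GroupConstruction θ K) (χ : D.SymmetryDual) (k : K) :
    D.inflate χ (AddSubgroup.inclusion D.le_symmetryLift k) = 1 := by
  rw [inflate_apply, (D.toSymmetryHom_eq_zero_iff _).2 k.2, ofAdd_zero, map_one]

/-- Two extensions of `ψ` differ by a character of `L` that is trivial on `K`, that is, by one
inflated from `H = L/K`. The extensions thus form a torsor under `Ĥ`. -/
theorem bijOn_component_character (D : GroupConstruction θ K) :
    Set.BijOn (fun χ => (D.component χ).character) Set.univ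
      {ψ' : AddChar D.symmetryLift Circle |
        ∀ k : K, ψ' (AddSubgroup.inclusion D.le_symmetryLift k) = D.character k} := by
  simp only [component_character]
  refine ⟨fun χ _ k => ?_, fun χ _ χ' _ h => ?_, fun ψ' hψ' => ?_⟩
  · rw [AddChar.mul_apply, extendedCharacter_inclusion, inflate_inclusion, mul_one]
  · have h' : D.inflate χ = D.inflate χ' := mul_left_cancel h
    refine PontryaginDual.ext fun a => ?_
    obtain ⟨l, hl⟩ := D.toSymmetryHom_surjective a.toAdd
    have := DFunLike.congr_fun h' l
    rwa [inflate_apply, inflate_apply, hl, ofAdd_toAdd] at this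
  · let φ : AddChar D.symmetryLift Circle := ψ' * D.extendedCharacter⁻¹
    have hker : D.toSymmetryHom.ker ≤ φ.toAddMonoidHom.ker := by
      intro l hl
      have hl' : (l : ℤ × ℤ) ∈ K := (D.toSymmetryHom_eq_zero_iff l).1 hl
      have e : l = AddSubgroup.inclusion D.le_symmetryLift ⟨l, hl'⟩ := rfl
      have : φ l = 1 := by
        rw [AddChar.mul_apply, AddChar.inv_apply', e, hψ', extendedCharacter_inclusion,
          mul_inv_cancel]
      exact this
    let g : D.symmetryGroup →+ Additive Circle :=
      D.toSymmetryHom.liftOfSurjective D.toSymmetryHom_surjective ⟨φ.toAddMonoidHom, hker⟩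
    have hg : ∀ l, g (D.toSymmetryHom l) = φ.toAddMonoidHom l :=
      AddMonoidHom.liftOfRightInverse_comp_apply _ _ _ _
    refine ⟨D.dualOfAddChar (AddChar.toAddMonoidHomEquiv.symm g), trivial, ?_⟩
    refine DFunLike.ext _ _ fun l => ?_
    have : D.inflate (D.dualOfAddChar (AddChar.toAddMonoidHomEquiv.symm g)) l = φ l :=
      congrArg Additive.toMul (hg l)
    change D.extendedCharacter l * _ = ψ' l
    refine (congrArg (D.extendedCharacter l * ·) this).trans ?_
    simp only [φ]
    rw [AddChar.mul_apply, AddChar.inv_apply', mul_left_comm, mul_inv_cancel, mul_one]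

theorem component_character_eq (D : GroupConstruction θ K) (χ : D.SymmetryDual)
    (l : D.symmetryLift) : (D.component χ).character l =
      (D.component 1).character l * χ (Multiplicative.ofAdd (D.toSymmetry l)) := by
  rw [component_character, component_character, AddChar.mul_apply, AddChar.mul_apply, mul_assoc]
  congr 1
  rw [inflate_apply, inflate_apply, PontryaginDual.one_apply, one_mul]
  rfl

/-! ### The graph -/

theorem xi_apply_self {X : Type} (x : X) : (xi x : EllTwo X) x = 1 := by
  classical
  simp [xi]

theorem xi_apply_ne {X : Type} {x y : X} (h : y ≠ x) : (xi x : EllTwo X) y = 0 := by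
  classical
  simp [xi, h]

/-- Points of the circle are nonzero, so the existence of an edge depends on labels and endpoints
but not on scalars. Hence constructions with equal labels have equal graphs. -/
theorem exists_ite_smul_xi_iff {X : Type} (p : Prop) [Decidable p] (z : Circle) (x y : X) :
    (∃ c : ℂ, c ≠ 0 ∧ (if p then (z : ℂ) else 0) • xi x = c • xi y) ↔ p ∧ x = y := by
  constructor
  · rintro ⟨c, hc, h⟩
    have hy := congrArg (fun v : EllTwo X => v y) h
    simp only [lp.coeFn_smul, Pi.smul_apply, smul_eq_mul, xi_apply_self, mul_one] at hy
    by_cases hp : p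
    · refine ⟨hp, ?_⟩
      by_contra hxy
      rw [xi_apply_ne (Ne.symm hxy), mul_zero] at hy
      exact hc hy.symm
    · rw [if_neg hp, zero_mul] at hy
      exact absurd hy.symm hc
  · rintro ⟨hp, rfl⟩
    exact ⟨z, Circle.coe_ne_zero z, by rw [if_pos hp]⟩

theorem atomicGraph_congr {D D' : GroupConstruction θ K} (hi : D.i = D'.i) (hj : D.j = D'.j) :
    atomicGraph D.rep = atomicGraph D'.rep := by
  simp only [atomicGraph, rep_e_xi, rep_f_xi, exists_ite_smul_xi_iff, hi, hj]

end GroupConstruction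


/-! ### Weighted shifts -/

theorem FTheta.induction {m n : ℕ} {θ : Equiv.Perm (Fin m × Fin n)} {P : FTheta θ → Prop}
    (one : P 1) (e : ∀ i, P (FTheta.e θ i)) (f : ∀ j, P (FTheta.f θ j))
    (mul : ∀ v w, P v → P w → P (v * w)) (w : FTheta θ) : P w := by
  obtain ⟨a, rfl⟩ := PresentedMonoid.surjective_mk w
  induction a with
  | one => exact one
  | of x =>
    cases x with
    | inl i => exact e i
    | inr j => exact f j
  | mul x y hx hy => exact mul _ _ hx hy

theorem norm_ite_circle_le (p : Prop) [Decidable p] (z : Circle) :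
    ‖(if p then (z : ℂ) else 0)‖ ≤ 1 := by
  split_ifs
  · exact (Circle.norm_coe _).le
  · simp

section WeightedShift

variable {X : Type}

theorem inner_xi_left (x : X) (v : EllTwo X) : inner ℂ (xi x) v = v x := by
  classical
  rw [xi, lp.inner_single_left]
  simp

/-- The standard basis of `ℓ²(X)` as a Hilbert basis. -/
def xiBasis (X : Type) : HilbertBasis X ℂ (EllTwo X) :=
  HilbertBasis.ofRepr (LinearIsometryEquiv.refl ℂ (EllTwo X))

theorem xiBasis_apply (x : X) : xiBasis X x = xi x := by
  classical
  rw [← (xiBasis X).repr_symm_single]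
  rfl

theorem topologicalClosure_span_xi :
    (Submodule.span ℂ (Set.range (xi : X → EllTwo X))).topologicalClosure = ⊤ := by
  rw [← (xiBasis X).dense_span]
  congr 3

theorem ellTwo_clm_ext {E : Type} [NormedAddCommGroup E] [NormedSpace ℂ E]
    {A B : EllTwo X →L[ℂ] E} (h : ∀ x, A (xi x) = B (xi x)) : A = B := by
  refine ContinuousLinearMap.ext_on (s := Set.range xi) ?_ ?_
  · rw [← Submodule.dense_iff_topologicalClosure_eq_top.symm.eq]
    exact topologicalClosure_span_xi
  · rintro _ ⟨x, rfl⟩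
    exact h x

theorem weightedShift_mul (τ τ' : Equiv.Perm X) (c c' : X → ℂ) (hc : ∀ x, ‖c x‖ ≤ 1)
    (hc' : ∀ x, ‖c' x‖ ≤ 1) :
    weightedShift τ c hc * weightedShift τ' c' hc' =
      weightedShift (τ * τ') (fun x => c (τ' x) * c' x) (fun x => by
        rw [norm_mul]
        exact mul_le_one₀ (hc _) (norm_nonneg _) (hc' _)) := by
  refine ellTwo_clm_ext fun x => ?_
  rw [mul_apply_eq_comp, weightedShift_xi, map_smul, weightedShift_xi,
    weightedShift_xi, smul_smul, mul_comm]
  rfl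

theorem adjoint_weightedShift (τ : Equiv.Perm X) (c : X → ℂ) (hc : ∀ x, ‖c x‖ ≤ 1) :
    ContinuousLinearMap.adjoint (weightedShift τ c hc) =
      weightedShift τ.symm (fun x => star (c (τ.symm x))) (fun x => by
        rw [norm_star]; exact hc _) := by
  symm
  rw [ContinuousLinearMap.eq_adjoint_iff]
  intro v w
  rw [lp.inner_eq_tsum, lp.inner_eq_tsum]
  refine Eq.trans (tsum_congr fun x => ?_) (τ.tsum_eq _)
  rw [weightedShift_apply, weightedShift_apply]
  simp
  ring

theorem weightedShift_isPartialIsometry (τ : Equiv.Perm X) (c : X → ℂ) (hc : ∀ x, ‖c x‖ ≤ 1)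
    (h : ∀ x, c x = 0 ∨ ‖c x‖ = 1) :
    weightedShift τ c hc * ContinuousLinearMap.adjoint (weightedShift τ c hc) *
      weightedShift τ c hc = weightedShift τ c hc := by
  refine ellTwo_clm_ext fun x => ?_
  rw [adjoint_weightedShift, weightedShift_mul, weightedShift_mul, weightedShift_xi,
    weightedShift_xi]
  have : c x * star (c x) * c x = c x := by
    rcases h x with h | h
    · simp [h]
    · rw [Complex.star_def, Complex.mul_conj, Complex.normSq_eq_norm_sq, h]
      simp
  rw [Equiv.Perm.mul_apply, Equiv.Perm.mul_apply, Equiv.symm_apply_apply, this]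

/-- The matrix entries of an operator commuting with a weighted shift. -/
theorem apply_xi_of_commute_weightedShift {τ : Equiv.Perm X} {c : X → ℂ} {hc : ∀ x, ‖c x‖ ≤ 1}
    {T : EllTwo X →L[ℂ] EllTwo X} (hT : Commute T (weightedShift τ c hc)) (x y : X) :
    c x * T (xi (τ x)) (τ y) = c y * T (xi x) y := by
  have h : T (weightedShift τ c hc (xi x)) = weightedShift τ c hc (T (xi x)) :=
    congrArg (fun A : EllTwo X →L[ℂ] EllTwo X => A (xi x)) hT.eq
  have h' := congrArg (fun v : EllTwo X => v (τ y)) h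
  simpa [weightedShift_xi, weightedShift_apply] using h'

/-- The matrix entries of an operator commuting with a family of weighted shifts that are
supported on the level sets of a labelling. -/
theorem apply_xi_of_commute_labelled {ι : Type} [DecidableEq ι] {τ : Equiv.Perm X} {i : X → ι}
    {α : X → Circle} {hc : ∀ (a : ι) (x : X), ‖(if a = i x then (α x : ℂ) else 0)‖ ≤ 1}
    {T : EllTwo X →L[ℂ] EllTwo X} (hT : ∀ a, Commute T (weightedShift τ _ (hc a))) (x y : X) :
    (T (xi (τ x)) (τ y) = 0 ↔ T (xi x) y = 0) ∧ (T (xi x) y ≠ 0 → i x = i y) ∧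
      T (xi (τ x)) (τ x) = T (xi x) x := by
  -- The letter is chosen to make the coefficient at `x` (in `h1`) or at `y` (in `h2`) nonzero. If
  -- the labels differ, `h1` kills the translated entry and `h2` the original one; if they agree,
  -- `h1` alone relates the two.
  have h1 := apply_xi_of_commute_weightedShift (hT (i x)) x y
  have h2 := apply_xi_of_commute_weightedShift (hT (i y)) x y
  have h3 := apply_xi_of_commute_weightedShift (hT (i x)) x x
  simp only [if_true] at h1 h2 h3
  have hx := (α x).coe_ne_zero
  have hy := (α y).coe_ne_zero
  refine ⟨?_, fun h => ?_, mul_left_cancel₀ hx h3⟩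
  · by_cases h : i x = i y
    · rw [if_pos h] at h1
      constructor
      · intro h0; rw [h0, mul_zero] at h1; exact (mul_eq_zero.1 h1.symm).resolve_left hy
      · intro h0; rw [h0, mul_zero] at h1; exact (mul_eq_zero.1 h1).resolve_left hx
    · rw [if_neg h, zero_mul] at h1
      rw [if_neg (Ne.symm h), zero_mul] at h2
      exact iff_of_true ((mul_eq_zero.1 h1).resolve_left hx)
        ((mul_eq_zero.1 h2.symm).resolve_left hy)
  · by_contra hne
    rw [if_neg (Ne.symm hne), zero_mul] at h2
    exact h ((mul_eq_zero.1 h2.symm).resolve_left hy)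

end WeightedShift

/-- The orthogonal projection onto a reducing subspace commutes with the operator. -/
theorem starProjection_commute {E : Type} [NormedAddCommGroup E] [InnerProductSpace ℂ E]
    [CompleteSpace E] (M : Submodule ℂ E) [M.HasOrthogonalProjection] (A : E →L[ℂ] E)
    (h : ∀ x ∈ M, A x ∈ M ∧ ContinuousLinearMap.adjoint A x ∈ M) :
    Commute M.starProjection A := by
  refine ContinuousLinearMap.ext fun x => ?_
  change M.starProjection (A x) = A (M.starProjection x)
  refine Submodule.eq_starProjection_of_mem_orthogonal
    (h _ (M.starProjection_apply_mem x)).1 ?_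
  rw [← map_sub, Submodule.mem_orthogonal]
  intro u hu
  rw [← ContinuousLinearMap.adjoint_inner_left]
  exact (Submodule.mem_orthogonal _ _).1 (M.sub_starProjection_mem_orthogonal x) _ (h u hu).2

/-! ### Atomicity and irreducibility of group constructions -/

namespace GroupConstruction

variable {m n : ℕ} {θ : Equiv.Perm (Fin m × Fin n)} {K : AddSubgroup (ℤ × ℤ)}

theorem rep_e (D : GroupConstruction θ K) (a : Fin m) : D.rep (FTheta.e θ a) = D.opE a := rfl

theorem rep_f (D : GroupConstruction θ K) (b : Fin n) : D.rep (FTheta.f θ b) = D.opF b := rfl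

/-- Weighted shifts with weights in `𝕋 ∪ {0}` are closed under products, so both conditions of
atomicity reduce to a single such shift. -/
theorem rep_eq_weightedShift (D : GroupConstruction θ K) (w : FTheta θ) :
    ∃ (τ : Equiv.Perm ((ℤ × ℤ) ⧸ K)) (c : (ℤ × ℤ) ⧸ K → ℂ) (hc : ∀ x, ‖c x‖ ≤ 1),
      (∀ x, c x = 0 ∨ ‖c x‖ = 1) ∧ D.rep w = weightedShift τ c hc := by
  induction w using FTheta.induction with
  | one =>
    refine ⟨1, fun _ => 1, fun _ => by simp, fun _ => Or.inr (by simp), ?_⟩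
    refine ellTwo_clm_ext fun x => ?_
    rw [weightedShift_xi, map_one, one_smul]
    rfl
  | e i =>
    refine ⟨_, _, _, fun x => ?_, D.rep_e i⟩
    split_ifs
    · exact Or.inr (Circle.norm_coe _)
    · exact Or.inl rfl
  | f j =>
    refine ⟨_, _, _, fun x => ?_, D.rep_f j⟩
    split_ifs
    · exact Or.inr (Circle.norm_coe _)
    · exact Or.inl rfl
  | mul v w hv hw =>
    obtain ⟨τ, c, hc, h, e⟩ := hv
    obtain ⟨τ', c', hc', h', e'⟩ := hw
    refine ⟨_, _, _, fun x => ?_, by rw [map_mul, e, e', weightedShift_mul]⟩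
    rcases h (τ' x) with h | h <;> rcases h' x with h' | h' <;> simp [h, h']

theorem isAtomicRep (D : GroupConstruction θ K) : IsAtomicRep D.rep := by
  refine ⟨fun w => ?_, _, xiBasis _, fun w k => ?_⟩
  · obtain ⟨τ, c, hc, h, e⟩ := D.rep_eq_weightedShift w
    rw [e]
    exact weightedShift_isPartialIsometry τ c hc h
  · obtain ⟨τ, c, hc, h, e⟩ := D.rep_eq_weightedShift w
    refine ⟨τ k, c k, h k, ?_⟩
    rw [e, xiBasis_apply, xiBasis_apply, weightedShift_xi]

/-- If the symmetry group is trivial, then the commutant of the representation is trivial. -/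
theorem eq_smul_one_of_commute (D : GroupConstruction θ K) (hD : D.symmetryGroup = ⊥)
    {T : EllTwo ((ℤ × ℤ) ⧸ K) →L[ℂ] EllTwo ((ℤ × ℤ) ⧸ K)} (hT : ∀ w, Commute T (D.rep w)) :
    T = T (xi 0) 0 • (1 : EllTwo ((ℤ × ℤ) ⧸ K) →L[ℂ] EllTwo ((ℤ × ℤ) ⧸ K)) := by
  have hE := fun x y => apply_xi_of_commute_labelled
    (hc := fun _ _ => norm_ite_circle_le _ _) (fun a => hT (FTheta.e θ a)) x y
  have hF := fun x y => apply_xi_of_commute_labelled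
    (hc := fun _ _ => norm_ite_circle_le _ _) (fun a => hT (FTheta.f θ a)) x y
  have hdiag : ∀ z : ℤ × ℤ, T (xi (QuotientAddGroup.mk z)) (QuotientAddGroup.mk z) =
      T (xi 0) 0 := by
    intro z
    induction z using int_prod_induction with
    | h0 => rfl
    | h1 x => rw [← (hE (QuotientAddGroup.mk x) 0).2.2]; rfl
    | h2 x => rw [← (hF (QuotientAddGroup.mk x) 0).2.2]; rfl
  have hoff : ∀ x y, T (xi x) y ≠ 0 → y = x := by
    intro x y hxy
    have key : ∀ z : ℤ × ℤ, T (xi (x + QuotientAddGroup.mk z)) (y + QuotientAddGroup.mk z) ≠ 0 := by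
      intro z
      induction z using int_prod_induction with
      | h0 =>
        rw [show (QuotientAddGroup.mk 0 : (ℤ × ℤ) ⧸ K) = 0 from rfl, add_zero, add_zero]
        exact hxy
      | h1 z =>
        rw [ne_eq, ne_eq, ← (hE (x + QuotientAddGroup.mk z) _).1]
        rw [QuotientAddGroup.mk_add, ← add_assoc, ← add_assoc]
        rfl
      | h2 z =>
        rw [ne_eq, ne_eq, ← (hF (x + QuotientAddGroup.mk z) _).1]
        rw [QuotientAddGroup.mk_add, ← add_assoc, ← add_assoc]
        rfl
    have hmem : y - x ∈ D.symmetryGroup := by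
      intro g
      obtain ⟨z, hz⟩ := QuotientAddGroup.mk_surjective (g - x)
      have e1 : x + QuotientAddGroup.mk z = g := by rw [hz]; abel
      have e2 : y + QuotientAddGroup.mk z = g + (y - x) := by rw [hz]; abel
      have := key z
      rw [e1, e2] at this
      exact ⟨((hE _ _).2.1 this).symm, ((hF _ _).2.1 this).symm⟩
    rw [hD, AddSubgroup.mem_bot] at hmem
    exact sub_eq_zero.1 hmem
  refine ellTwo_clm_ext fun x => lp.ext (funext fun y => ?_)
  change T (xi x) y = T (xi 0) 0 * xi x y
  by_cases h : y = x
  · subst h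
    obtain ⟨z, rfl⟩ := QuotientAddGroup.mk_surjective y
    rw [xi_apply_self, mul_one, hdiag]
  · rw [xi_apply_ne h, mul_zero]
    exact not_not.1 fun h' => h (hoff x y h')

/-- The projection onto a reducing subspace lies in the commutant, hence is a scalar `c`. The
subspace is trivial if `c = 0` and everything otherwise. -/
theorem isIrreducibleRep (D : GroupConstruction θ K) (hD : D.symmetryGroup = ⊥) :
    IsIrreducibleRep D.rep := by
  refine ⟨⟨xi 0, 0, fun h => ?_⟩, fun M hM h => ?_⟩
  · have := congrArg (fun v : EllTwo ((ℤ × ℤ) ⧸ K) => v 0) h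
    simp [xi_apply_self] at this
  · have : CompleteSpace M := hM.completeSpace_coe
    have hP := D.eq_smul_one_of_commute hD
      (fun w => starProjection_commute M (D.rep w) (fun x hx => h w x hx))
    set c := M.starProjection (xi 0) 0
    have hx : ∀ x, M.starProjection x = c • x := fun x => by rw [hP]; rfl
    by_cases hc : c = 0
    · left
      refine (Submodule.eq_bot_iff _).2 fun x hxM => ?_
      rw [← Submodule.starProjection_eq_self_iff.2 hxM, hx, hc, zero_smul]
    · right
      refine (Submodule.eq_top_iff').2 fun x => ?_
      have := M.starProjection_apply_mem x
      rw [hx] at this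
      exact (M.smul_mem_iff hc).1 this

end GroupConstruction


/-! ### Fourier analysis on the dual of a discrete abelian group -/

namespace PontryaginDual

section Continuous

variable {A : Type} [CommGroup A] [TopologicalSpace A]

theorem continuous_eval (a : A) : Continuous fun χ : PontryaginDual A => χ a :=
  (continuous_eval_const a : Continuous fun f : C(A, Circle) => f a).comp
    (ContinuousMonoidHom.isInducing_toContinuousMap A Circle).continuous

/-- Evaluation at `a`, as a continuous function on the dual group. -/
def evalMap (a : A) : C(PontryaginDual A, ℂ) :=
  ⟨fun χ => (χ a : ℂ), continuous_subtype_val.comp (continuous_eval a)⟩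

theorem evalMap_apply (a : A) (χ : PontryaginDual A) : evalMap a χ = (χ a : ℂ) := rfl

theorem star_evalMap (a : A) : star (evalMap a) = evalMap a⁻¹ := by
  ext χ
  change star (χ a : ℂ) = (χ a⁻¹ : ℂ)
  rw [_root_.map_inv, Circle.coe_inv_eq_conj]
  rfl

theorem evalMap_mul (a b : A) : evalMap (a * b) = evalMap a * evalMap b := by
  ext χ
  simp [evalMap_apply]

section VectorField

variable {X Y : Type} (κ : X → Circle) (y : X → Y) (a : X → A)

/-- The function `χ ↦ κ χ(a) ξ_y` on the dual group. -/
def vectorField (x : X) (χ : PontryaginDual A) : EllTwo Y :=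
  ((κ x : ℂ) * (χ (a x) : ℂ)) • xi (y x)

theorem inner_vectorField_left (x : X) (χ : PontryaginDual A) (v : EllTwo Y) :
    inner ℂ (vectorField κ y a x χ) v = star (κ x : ℂ) * (star (χ (a x) : ℂ) * v (y x)) := by
  have h : ∀ z w u : ℂ, (starRingEnd ℂ) (z * w) * u = star z * (star w * u) := fun z w u => by
    rw [_root_.map_mul, mul_assoc]; rfl
  rw [vectorField, inner_smul_left, inner_xi_left]
  exact h _ _ _

variable [MeasurableSpace (PontryaginDual A)] [BorelSpace (PontryaginDual A)]
  (μ : Measure (PontryaginDual A))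

theorem memLp_vectorField [IsFiniteMeasure μ] (x : X) :
    MemLp (vectorField κ y a x) 2 μ := by
  refine MemLp.of_bound (C := ‖(xi (y x) : EllTwo Y)‖) ?_ (.of_forall fun χ => ?_)
  · have hc : Continuous fun χ : PontryaginDual A => (κ x : ℂ) * (χ (a x) : ℂ) :=
      continuous_const.mul (evalMap (a x)).continuous
    exact (hc.stronglyMeasurable.smul_const _).aestronglyMeasurable
  · rw [vectorField, norm_smul, norm_mul, Circle.norm_coe, Circle.norm_coe, one_mul, one_mul]

/-- The function `χ ↦ κ χ(a) ξ_y` as an element of `L²`. -/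
def vectorFieldLp [IsFiniteMeasure μ] (x : X) : Lp (EllTwo Y) 2 μ :=
  (memLp_vectorField κ y a μ x).toLp

theorem coeFn_vectorFieldLp [IsFiniteMeasure μ] (x : X) :
    vectorFieldLp κ y a μ x =ᵐ[μ] vectorField κ y a x :=
  MemLp.coeFn_toLp _

end VectorField

variable [DiscreteTopology A]

/-- Stone–Weierstrass: evaluations separate the points of the dual and are closed under conjugation.
They are also closed under products, so the algebra they generate is just their linear span. -/
theorem span_evalMap_closure_eq_top :
    (Submodule.span ℂ (Set.range (evalMap : A → C(PontryaginDual A, ℂ)))).topologicalClosure =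
      ⊤ := by
  let S : StarSubalgebra ℂ C(PontryaginDual A, ℂ) :=
    { toSubalgebra := Algebra.adjoin ℂ (Set.range evalMap)
      star_mem' := by
        change Algebra.adjoin ℂ (Set.range evalMap) ≤ star (Algebra.adjoin ℂ (Set.range evalMap))
        refine Algebra.adjoin_le ?_
        rintro - ⟨a, rfl⟩
        exact Algebra.subset_adjoin ⟨a⁻¹, (star_evalMap a).symm⟩ }
  have hS : Subalgebra.toSubmodule S.toSubalgebra =
      Submodule.span ℂ (Set.range (evalMap : A → C(PontryaginDual A, ℂ))) := by
    have hcl : ((Submonoid.closure (Set.range (evalMap : A → C(PontryaginDual A, ℂ))) :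
        Submonoid C(PontryaginDual A, ℂ)) : Set C(PontryaginDual A, ℂ)) ⊆ Set.range evalMap := by
      intro x hx
      refine Submonoid.closure_induction (fun _ => id) ⟨1, ?_⟩ ?_ hx
      · ext χ
        simp [evalMap_apply]
      · rintro - - - - ⟨a, rfl⟩ ⟨b, rfl⟩
        exact ⟨a * b, evalMap_mul a b⟩
    exact Algebra.adjoin_eq_span_of_subset (R := ℂ) (hcl.trans Submodule.subset_span)
  have hsep : S.SeparatesPoints := by
    intro χ χ' h
    obtain ⟨a, ha⟩ := DFunLike.ne_iff.1 h
    refine ⟨_, ⟨evalMap a, Algebra.subset_adjoin ⟨a, rfl⟩, rfl⟩, ?_⟩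
    exact fun h => ha (Subtype.ext h)
  rw [← hS]
  exact congr_arg (Subalgebra.toSubmodule <| StarSubalgebra.toSubalgebra ·)
    (ContinuousMap.starSubalgebra_topologicalClosure_eq_top_of_separatesPoints S hsep)

theorem exists_apply_ne_one {a : A} (ha : a ≠ 1) : ∃ χ : PontryaginDual A, χ a ≠ 1 := by
  obtain ⟨ψ, hψ⟩ := exists_addChar_ne_one (A := Additive A) (a := Additive.ofMul a) ha
  exact ⟨(⟨⟨⟨fun x => ψ (Additive.ofMul x), ψ.map_zero_eq_one⟩,
    fun x y => ψ.map_add_eq_mul _ _⟩, continuous_of_discreteTopology⟩ : A →ₜ* Circle), hψ⟩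

end Continuous

variable {A : Type} [CommGroup A] [TopologicalSpace A] [DiscreteTopology A]
  [MeasurableSpace (PontryaginDual A)] [BorelSpace (PontryaginDual A)]
  (μ : Measure (PontryaginDual A))

/-- Translation by a `χ₀` with `χ₀(a) ≠ 1` preserves the integral and also multiplies it by `χ₀(a)`.
-/
theorem integral_apply_eq_zero [μ.IsMulLeftInvariant] {a : A} (ha : a ≠ 1) :
    ∫ χ : PontryaginDual A, (χ a : ℂ) ∂μ = 0 := by
  obtain ⟨χ₀, h⟩ := exists_apply_ne_one ha
  have h1 := integral_mul_left_eq_self (μ := μ) (fun χ : PontryaginDual A => (χ a : ℂ)) χ₀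
  have h2 : ∀ χ : PontryaginDual A, ((χ₀ * χ) a : ℂ) = (χ₀ a : ℂ) * (χ a : ℂ) := fun χ => by
    rw [← Circle.coe_mul]; rfl
  simp only [h2, integral_const_mul] at h1
  by_contra hne
  exact h (Subtype.ext (mul_right_cancel₀ hne (h1.trans (one_mul _).symm)))

/-- Uniform density passes to `L²`, since continuous functions are dense there for a weakly regular
finite measure. -/
theorem span_evalLp_closure_eq_top [IsFiniteMeasure μ] [μ.WeaklyRegular] :
    (Submodule.span ℂ (Set.range fun a : A =>
      ContinuousMap.toLp (E := ℂ) 2 μ ℂ (evalMap a))).topologicalClosure = ⊤ := by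
  convert! (ContinuousMap.toLp_denseRange ℂ μ ℂ (p := 2)
    (by norm_num)).topologicalClosure_map_submodule (span_evalMap_closure_eq_top (A := A))
  rw [Submodule.map_span, Set.range_comp']
  rfl

/-- A square integrable function whose Fourier coefficients vanish is zero. -/
theorem ae_eq_zero_of_integral_eq_zero [IsFiniteMeasure μ] [μ.WeaklyRegular]
    (f : Lp ℂ 2 μ) (hf : ∀ a : A, ∫ χ, star (χ a : ℂ) * f χ ∂μ = 0) : f = 0 := by
  have h : f ∈ (Submodule.span ℂ (Set.range fun a : A =>
      ContinuousMap.toLp (E := ℂ) 2 μ ℂ (evalMap a)))ᗮ := by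
    rw [Submodule.mem_orthogonal]
    intro g hg
    induction hg using Submodule.span_induction with
    | mem g hg =>
      obtain ⟨a, rfl⟩ := hg
      rw [L2.inner_def, ← hf a]
      refine integral_congr_ae ?_
      filter_upwards [ContinuousMap.coeFn_toLp (E := ℂ) (p := 2) (𝕜 := ℂ) μ (evalMap a)] with χ hχ
      rw [hχ, evalMap_apply, RCLike.inner_apply, mul_comm]
      rfl
    | zero => exact inner_zero_left _
    | add g g' _ _ h h' => rw [inner_add_left, h, h', add_zero]
    | smul c g _ h => rw [inner_smul_left, h, mul_zero]
  rwa [(Submodule.topologicalClosure_eq_top_iff).1 (span_evalLp_closure_eq_top μ),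
    Submodule.mem_bot] at h

variable {X Y : Type} (κ : X → Circle) (y : X → Y) (a : X → A)

/-- The inner product factors into a Kronecker delta in `Y` and the integral of `χ(a⁻¹a')`. For
distinct indices the coordinate pairs differ, so one factor vanishes. -/
theorem orthonormal_vectorFieldLp [IsProbabilityMeasure μ] [μ.IsMulLeftInvariant]
    (hinj : Function.Injective fun x => (y x, a x)) :
    Orthonormal ℂ (vectorFieldLp κ y a μ) := by
  classical
  rw [orthonormal_iff_ite]
  intro x x'
  have h : inner ℂ (vectorFieldLp κ y a μ x) (vectorFieldLp κ y a μ x') =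
      star (κ x : ℂ) * (κ x' : ℂ) * (xi (y x') : EllTwo Y) (y x) *
        ∫ χ : PontryaginDual A, (χ ((a x)⁻¹ * a x') : ℂ) ∂μ := by
    rw [L2.inner_def, ← integral_const_mul]
    refine integral_congr_ae ?_
    filter_upwards [coeFn_vectorFieldLp κ y a μ x, coeFn_vectorFieldLp κ y a μ x'] with χ h h'
    rw [h, h', inner_vectorField_left, vectorField, lp.coeFn_smul, Pi.smul_apply, smul_eq_mul]
    have e : (χ ((a x)⁻¹ * a x') : ℂ) = star (χ (a x) : ℂ) * (χ (a x') : ℂ) := by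
      rw [_root_.map_mul, _root_.map_inv, Circle.coe_mul, Circle.coe_inv_eq_conj]
      rfl
    have e' : ∀ z w z' w' u : ℂ, z * (w * (z' * w' * u)) = z * z' * u * (w * w') :=
      fun z w z' w' u => by ring
    rw [e]
    exact e' _ _ _ _ _
  rw [h]
  split_ifs with hx
  · subst hx
    rw [GroupConstruction.xi_apply_self, inv_mul_cancel]
    have e : star (κ x : ℂ) * (κ x : ℂ) = 1 := by
      rw [Complex.star_def, Complex.conj_mul', Circle.norm_coe]
      simp
    rw [e]
    simp
  · by_cases hy : y x = y x'
    · rw [integral_apply_eq_zero, mul_zero]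
      intro ha
      exact hx (hinj (Prod.ext hy (inv_mul_eq_one.1 ha)))
    · rw [GroupConstruction.xi_apply_ne hy, mul_zero, zero_mul]

/-- Orthogonality to all the fields says that each coordinate function has vanishing Fourier
coefficients. Countability of `Y` lets the exceptional null sets of the coordinates be united. -/
theorem orthogonal_span_vectorFieldLp [IsFiniteMeasure μ] [μ.WeaklyRegular] [Countable Y]
    (hsurj : Function.Surjective fun x => (y x, a x)) :
    (Submodule.span ℂ (Set.range (vectorFieldLp κ y a μ)))ᗮ = ⊥ := by
  refine (Submodule.eq_bot_iff _).2 fun f hf => ?_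
  have hcoord : ∀ z : Y, ∀ᵐ χ ∂μ, f χ z = 0 := by
    intro z
    have hfz := (innerSL ℂ (xi z : EllTwo Y)).coeFn_compLp f
    have h0 : (innerSL ℂ (xi z : EllTwo Y)).compLp f = 0 := by
      refine ae_eq_zero_of_integral_eq_zero μ _ fun b => ?_
      obtain ⟨x, hx⟩ := hsurj (z, b)
      obtain ⟨rfl, rfl⟩ := Prod.ext_iff.1 hx
      have hin := (Submodule.mem_orthogonal _ _).1 hf _ (Submodule.subset_span ⟨x, rfl⟩)
      rw [L2.inner_def] at hin
      have : ∫ χ, inner ℂ (vectorFieldLp κ y a μ x χ) (f χ) ∂μ = star (κ x : ℂ) *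
          ∫ χ, star (χ (a x) : ℂ) * (innerSL ℂ (xi (y x) : EllTwo Y)).compLp f χ ∂μ := by
        rw [← integral_const_mul]
        refine integral_congr_ae ?_
        filter_upwards [coeFn_vectorFieldLp κ y a μ x, hfz] with χ h h'
        rw [h, h', inner_vectorField_left, innerSL_apply_apply, inner_xi_left]
      rw [this] at hin
      exact (mul_eq_zero.1 hin).resolve_left (star_ne_zero.2 (κ x).coe_ne_zero)
    filter_upwards [hfz, Lp.eq_zero_iff_ae_eq_zero.1 h0] with χ h h'
    rw [← inner_xi_left, ← innerSL_apply_apply (𝕜 := ℂ), ← h, h']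
    rfl
  rw [Lp.eq_zero_iff_ae_eq_zero]
  filter_upwards [ae_all_iff.2 hcoord] with χ h
  exact lp.ext (funext h)

/-- The functions `χ ↦ κ χ(a) ξ_y` form a Hilbert basis of `L²(Â; ℓ²(Y))`. -/
def vectorFieldBasis [IsProbabilityMeasure μ] [μ.IsMulLeftInvariant] [μ.WeaklyRegular]
    [Countable Y] (hb : Function.Bijective fun x => (y x, a x)) :
    HilbertBasis X ℂ (Lp (EllTwo Y) 2 μ) :=
  HilbertBasis.mkOfOrthogonalEqBot (orthonormal_vectorFieldLp μ κ y a hb.1)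
    (orthogonal_span_vectorFieldLp μ κ y a hb.2)

theorem vectorFieldBasis_apply [IsProbabilityMeasure μ] [μ.IsMulLeftInvariant] [μ.WeaklyRegular]
    [Countable Y] (hb : Function.Bijective fun x => (y x, a x)) (x : X) :
    vectorFieldBasis μ κ y a hb x = vectorFieldLp κ y a μ x :=
  congrFun (HilbertBasis.coe_mkOfOrthogonalEqBot _ _) x

theorem vectorFieldBasis_repr_symm_xi [IsProbabilityMeasure μ] [μ.IsMulLeftInvariant]
    [μ.WeaklyRegular] [Countable Y] (hb : Function.Bijective fun x => (y x, a x)) (x : X) :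
    (vectorFieldBasis μ κ y a hb).repr.symm (xi x) = vectorFieldLp κ y a μ x := by
  classical
  rw [← vectorFieldBasis_apply μ κ y a hb]
  convert! (vectorFieldBasis μ κ y a hb).repr_symm_single x

end PontryaginDual

/-! ### Decomposable operators and direct integrals -/

/-- `L²` convergence gives almost everywhere convergence along a subsequence, and each `t ω` is
continuous. The exceptional set may depend on `x`, and no uniform bound on `t` is needed. -/
theorem ae_eq_apply_of_span {Ω : Type} [MeasurableSpace Ω] {μ : Measure Ω} {E F : Type}
    [NormedAddCommGroup E] [NormedSpace ℂ E] [NormedAddCommGroup F] [NormedSpace ℂ F]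
    (P Q : E →L[ℂ] Lp F 2 μ) (t : Ω → (F →L[ℂ] F)) {s : Set E}
    (hs : (Submodule.span ℂ s).topologicalClosure = ⊤)
    (h : ∀ x ∈ s, ∀ᵐ ω ∂μ, P x ω = t ω (Q x ω)) (x : E) : ∀ᵐ ω ∂μ, P x ω = t ω (Q x ω) := by
  have hspan : ∀ x ∈ Submodule.span ℂ s, ∀ᵐ ω ∂μ, P x ω = t ω (Q x ω) := by
    intro x hx
    induction hx using Submodule.span_induction with
    | mem x hx => exact h x hx
    | zero =>
      rw [map_zero, map_zero]
      filter_upwards [Lp.coeFn_zero F 2 μ] with ω hω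
      rw [hω, Pi.zero_apply, map_zero]
    | add x x' _ _ h h' =>
      rw [map_add, map_add]
      filter_upwards [h, h', Lp.coeFn_add (P x) (P x'), Lp.coeFn_add (Q x) (Q x')]
        with ω h h' h1 h2
      rw [h1, h2, Pi.add_apply, Pi.add_apply, h, h', map_add]
    | smul c x _ h =>
      rw [map_smul, map_smul]
      filter_upwards [h, Lp.coeFn_smul c (P x), Lp.coeFn_smul c (Q x)] with ω h h1 h2
      rw [h1, h2, Pi.smul_apply, Pi.smul_apply, h, map_smul]
  have hx : x ∈ closure (Submodule.span ℂ s : Set E) := by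
    rw [← Submodule.topologicalClosure_coe, hs]; trivial
  obtain ⟨v, hv, hvx⟩ := mem_closure_iff_seq_limit.1 hx
  obtain ⟨ns, hns, hP⟩ := (tendstoInMeasure_of_tendsto_Lp
    ((P.continuous.tendsto x).comp hvx)).exists_seq_tendsto_ae
  -- The second subsequence is taken inside the first, so that along it both images converge.
  obtain ⟨ms, hms, hQ⟩ := (tendstoInMeasure_of_tendsto_Lp
    ((Q.continuous.tendsto x).comp (hvx.comp hns.tendsto_atTop))).exists_seq_tendsto_ae
  filter_upwards [hP, hQ, ae_all_iff.2 fun k => hspan (v k) (hv k)] with ω hP hQ hk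
  refine tendsto_nhds_unique (hP.comp hms.tendsto_atTop) ?_
  refine (((t ω).continuous.tendsto _).comp hQ).congr fun k => ?_
  exact (hk _).symm

theorem stronglyMeasurable_of_span {Ω : Type} [MeasurableSpace Ω] {E F : Type}
    [NormedAddCommGroup E] [NormedSpace ℂ E] [NormedAddCommGroup F] [NormedSpace ℂ F]
    (t : Ω → (E →L[ℂ] F)) {s : Set E} (hs : (Submodule.span ℂ s).topologicalClosure = ⊤)
    (h : ∀ x ∈ s, StronglyMeasurable fun ω => t ω x) (x : E) :
    StronglyMeasurable fun ω => t ω x := by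
  have hspan : ∀ x ∈ Submodule.span ℂ s, StronglyMeasurable fun ω => t ω x := by
    intro x hx
    induction hx using Submodule.span_induction with
    | mem x hx => exact h x hx
    | zero => simpa using stronglyMeasurable_const
    | add x x' _ _ h h' => simp only [map_add]; exact h.add h'
    | smul c x _ h => simp only [map_smul]; exact h.const_smul c
  have hx : x ∈ closure (Submodule.span ℂ s : Set E) := by
    rw [← Submodule.topologicalClosure_coe, hs]; trivial
  obtain ⟨v, hv, hvx⟩ := mem_closure_iff_seq_limit.1 hx
  refine stronglyMeasurable_of_tendsto Filter.atTop (fun k => hspan (v k) (hv k)) ?_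
  exact tendsto_pi_nhds.2 fun ω => ((t ω).continuous.tendsto x).comp hvx

/-- Over a finite space whose points have positive mass, a direct integral is a direct sum. -/
theorem IsDirectIntegralRep.isDirectSumRep {S : Type} [Monoid S] {E : Type}
    [NormedAddCommGroup E] [InnerProductSpace ℂ E] {Ω : Type} [MeasurableSpace Ω] [Finite Ω]
    [MeasurableSingletonClass Ω] {μ : Measure Ω} [IsFiniteMeasure μ] (hμ : ∀ ω, μ {ω} ≠ 0)
    {F : Type} [NormedAddCommGroup F] [InnerProductSpace ℂ F] {σ : S →* (E →L[ℂ] E)}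
    {τ : Ω → (S →* (F →L[ℂ] F))} (h : IsDirectIntegralRep μ σ τ) : IsDirectSumRep σ τ := by
  have := Fintype.ofFinite Ω
  obtain ⟨-, U, hU⟩ := h
  -- As every point has positive mass, the only null set is empty.
  have hae : ∀ p : Ω → Prop, (∀ᵐ ω ∂μ, p ω) → ∀ ω, p ω := by
    intro p hp ω
    by_contra hω
    exact hμ ω (measure_mono_null (Set.singleton_subset_iff.2 hω) (ae_iff.1 hp))
  have hpos : ∀ ω, 0 < μ.real {ω} := fun ω =>
    ENNReal.toReal_pos (hμ ω) (measure_ne_top _ _)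
  -- The square root makes `|c ω|²` the mass of `ω`, so scaling by `c` turns the integral norm into
  -- the `ℓ²` norm.
  let c : Ω → ℂ := fun ω => (Real.sqrt (μ.real {ω}) : ℂ)
  have hc : ∀ ω, c ω ≠ 0 := fun ω =>
    Complex.ofReal_ne_zero.2 (Real.sqrt_ne_zero'.2 (hpos ω))
  let V : Lp F 2 μ →ₗᵢ[ℂ] lp (fun _ : Ω => F) 2 :=
    { toFun := fun f => ⟨fun ω => c ω • f ω, memℓp_gen (Summable.of_finite ..)⟩
      map_add' := fun f g => lp.ext (funext fun ω => by
        change c ω • (f + g : Lp F 2 μ) ω = c ω • f ω + c ω • g ω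
        rw [hae _ (Lp.coeFn_add f g) ω, Pi.add_apply, smul_add])
      map_smul' := fun a f => lp.ext (funext fun ω => by
        change c ω • (a • f : Lp F 2 μ) ω = a • c ω • f ω
        rw [hae _ (Lp.coeFn_smul a f) ω, Pi.smul_apply, smul_comm])
      norm_map' := fun f => by
        rw [← sq_eq_sq₀ (norm_nonneg _) (norm_nonneg _), ← inner_self_eq_norm_sq (𝕜 := ℂ),
          ← inner_self_eq_norm_sq (𝕜 := ℂ) f, L2.inner_def, lp.inner_eq_tsum, tsum_fintype,
          integral_fintype Integrable.of_finite]
        congr 1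
        refine Finset.sum_congr rfl fun ω _ => ?_
        change inner ℂ (c ω • f ω) (c ω • f ω) = _
        rw [inner_smul_left, inner_smul_right, ← mul_assoc, Complex.conj_ofReal,
          ← Complex.ofReal_mul, Real.mul_self_sqrt (hpos ω).le]
        exact (Complex.real_smul ..).symm }
  have hV : Function.Surjective V := by
    intro g
    have hg : MemLp (fun ω => (c ω)⁻¹ • g ω) 2 μ := MemLp.of_discrete
    refine ⟨hg.toLp, lp.ext (funext fun ω => ?_)⟩
    change c ω • hg.toLp _ ω = g ω
    rw [hae _ hg.coeFn_toLp ω, smul_inv_smul₀ (hc ω)]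
  refine ⟨U.trans (LinearIsometryEquiv.ofSurjective V hV), fun w x ω => ?_⟩
  change c ω • U (σ w x) ω = τ ω w (c ω • U x ω)
  rw [hae _ (hU w x) ω, map_smul]


namespace GroupConstruction

variable {m n : ℕ} {θ : Equiv.Perm (Fin m × Fin n)} {K : AddSubgroup (ℤ × ℤ)}

theorem quotientSection_mk (K : AddSubgroup (ℤ × ℤ)) (x : ℤ × ℤ) :
    ∃ k : K, quotientSection K (QuotientAddGroup.mk x) = x + k :=
  ⟨-sectionDefect K x, by
    rw [AddSubgroup.coe_neg, ← sub_eq_add_neg, eq_sub_iff_add_eq]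
    exact quotientSection_add_sectionDefect K x⟩

theorem mk_add_coe (D : GroupConstruction θ K) (x : ℤ × ℤ) (k : K) :
    (QuotientAddGroup.mk (x + (k : ℤ × ℤ)) : (ℤ × ℤ) ⧸ D.symmetryLift) =
      QuotientAddGroup.mk x := by
  rw [QuotientAddGroup.mk_add, (QuotientAddGroup.eq_zero_iff (k : ℤ × ℤ)).2
    (D.le_symmetryLift k.2), add_zero]

theorem sectionDefect_add_inclusion (D : GroupConstruction θ K) (x : ℤ × ℤ) (k : K) :
    sectionDefect D.symmetryLift (x + (k : ℤ × ℤ)) =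
      sectionDefect D.symmetryLift x + AddSubgroup.inclusion D.le_symmetryLift k :=
  sectionDefect_add_coe D.symmetryLift x (AddSubgroup.inclusion D.le_symmetryLift k)

/-! ### Coordinates of `G` with respect to `G / H` and `H` -/

/-- The `H`-coordinate of the class of an element of `ℤ²`. -/
def symmetryPart (D : GroupConstruction θ K) (x : ℤ × ℤ) : D.symmetryGroup :=
  D.toSymmetryHom (sectionDefect D.symmetryLift x)

/-- The scalar by which the vector field at the class of `x` is normalised. -/
def gaugeScalar (D : GroupConstruction θ K) (x : ℤ × ℤ) : Circle :=
  (D.pathScalar x)⁻¹ * D.extendedCharacter (sectionDefect D.symmetryLift x)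

theorem symmetryPart_add_coe (D : GroupConstruction θ K) (x : ℤ × ℤ) (k : K) :
    D.symmetryPart (x + k) = D.symmetryPart x := by
  rw [symmetryPart, symmetryPart, sectionDefect_add_inclusion, map_add,
    (D.toSymmetryHom_eq_zero_iff (AddSubgroup.inclusion D.le_symmetryLift k)).2 k.2, add_zero]

/-- Changing the lift by `k` multiplies both the path scalar and the extended character of the
defect by `ψ(k)`, and these factors cancel. Here the decomposition uses that the character on `L`
extends `ψ`. -/
theorem gaugeScalar_add_coe (D : GroupConstruction θ K) (x : ℤ × ℤ) (k : K) :
    D.gaugeScalar (x + k) = D.gaugeScalar x := by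
  rw [gaugeScalar, gaugeScalar, sectionDefect_add_inclusion, AddChar.map_add_eq_mul,
    extendedCharacter_inclusion, pathScalar_add_coe, mul_inv, mul_mul_mul_comm, inv_mul_cancel,
    mul_one]

theorem mk_eq_add_symmetryPart (D : GroupConstruction θ K) (x : ℤ × ℤ) :
    (QuotientAddGroup.mk x : (ℤ × ℤ) ⧸ K) =
      QuotientAddGroup.mk (quotientSection D.symmetryLift (QuotientAddGroup.mk x)) +
        (D.symmetryPart x : (ℤ × ℤ) ⧸ K) := by
  conv_lhs => rw [← quotientSection_add_sectionDefect D.symmetryLift x]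
  rfl

/-- The `G / H`-coordinate of an element of `G`. -/
def toQuotient (D : GroupConstruction θ K) (g : (ℤ × ℤ) ⧸ K) : (ℤ × ℤ) ⧸ D.symmetryLift :=
  QuotientAddGroup.mk (quotientSection K g)

/-- The `H`-coordinate of an element of `G`. -/
def symmetryCoord (D : GroupConstruction θ K) (g : (ℤ × ℤ) ⧸ K) :
    Multiplicative D.symmetryGroup :=
  Multiplicative.ofAdd (D.symmetryPart (quotientSection K g))

theorem toQuotient_mk (D : GroupConstruction θ K) (x : ℤ × ℤ) :
    D.toQuotient (QuotientAddGroup.mk x) = QuotientAddGroup.mk x := by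
  obtain ⟨k, hk⟩ := quotientSection_mk K x
  rw [toQuotient, hk, mk_add_coe]

theorem symmetryCoord_mk (D : GroupConstruction θ K) (x : ℤ × ℤ) :
    D.symmetryCoord (QuotientAddGroup.mk x) = Multiplicative.ofAdd (D.symmetryPart x) := by
  obtain ⟨k, hk⟩ := quotientSection_mk K x
  rw [symmetryCoord, hk, symmetryPart_add_coe]

theorem bijective_coordinates (D : GroupConstruction θ K) :
    Function.Bijective fun g => (D.toQuotient g, D.symmetryCoord g) := by
  refine ⟨fun g g' h => ?_, fun ⟨y, h⟩ => ?_⟩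
  · obtain ⟨x, rfl⟩ := QuotientAddGroup.mk_surjective g
    obtain ⟨x', rfl⟩ := QuotientAddGroup.mk_surjective g'
    obtain ⟨h1, h2⟩ := Prod.ext_iff.1 h
    simp only [toQuotient_mk, symmetryCoord_mk] at h1 h2
    rw [D.mk_eq_add_symmetryPart, D.mk_eq_add_symmetryPart x', h1,
      Multiplicative.ofAdd.injective h2]
  · obtain ⟨l, hl⟩ := D.toSymmetryHom_surjective h.toAdd
    have hy : sectionDefect D.symmetryLift (quotientSection D.symmetryLift y) = 0 :=
      Subtype.ext (by simp [sectionDefect])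
    refine ⟨QuotientAddGroup.mk (quotientSection D.symmetryLift y + (l : ℤ × ℤ)),
      Prod.ext ?_ ?_⟩
    · simp only [toQuotient_mk]
      rw [QuotientAddGroup.mk_add, (QuotientAddGroup.eq_zero_iff (l : ℤ × ℤ)).2 l.2, add_zero,
        mk_quotientSection]
    · simp only [symmetryCoord_mk]
      rw [symmetryPart, sectionDefect_add_coe, hy, zero_add, hl, ofAdd_toAdd]

/-! ### The direct integral decomposition -/

/-- The image of `ξ_{[x]}` in the direct integral. -/
def integralField (D : GroupConstruction θ K) (x : ℤ × ℤ) (χ : D.SymmetryDual) :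
    EllTwo ((ℤ × ℤ) ⧸ D.symmetryLift) :=
  (((D.pathScalar x)⁻¹ * (D.extendedCharacter * D.inflate χ)
    (sectionDefect D.symmetryLift x) : Circle) : ℂ) • xi (QuotientAddGroup.mk x)

/-- The abstract basis field is computed from a chosen representative; this formula holds for every
lift, so `x` and `x + e` can be compared directly. -/
theorem vectorField_mk (D : GroupConstruction θ K) (x : ℤ × ℤ) (χ : D.SymmetryDual) :
    PontryaginDual.vectorField (fun g => D.gaugeScalar (quotientSection K g)) D.toQuotient
      D.symmetryCoord (QuotientAddGroup.mk x) χ = D.integralField x χ := by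
  obtain ⟨k, hk⟩ := quotientSection_mk K x
  rw [PontryaginDual.vectorField, toQuotient_mk, symmetryCoord_mk, hk, gaugeScalar_add_coe,
    integralField, gaugeScalar, AddChar.mul_apply, ← mul_assoc, Circle.coe_mul _ (D.inflate χ _)]
  rfl

/-- The edge scalar of `σ_χ` moves `ω_χ(d(x))` to `ω_χ(d(x + (1,0)))`, and the change of the path
scalar supplies `α`. The resulting coefficient is that of `σ` and is independent of `χ`. -/
theorem rep_e_integralField (D : GroupConstruction θ K) (a : Fin m) (x : ℤ × ℤ)
    (χ : D.SymmetryDual) : (D.component χ).rep (FTheta.e θ a) (D.integralField x χ) =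
      (if a = D.i (QuotientAddGroup.mk x) then (D.α (QuotientAddGroup.mk x) : ℂ) else 0) •
        D.integralField (x + (1, 0)) χ := by
  rw [integralField, integralField, map_smul, rep_e_xi, component, quotientBy_i_mk, smul_smul,
    smul_smul]
  refine congrArg₂ _ ?_ rfl
  split_ifs
  · rw [← Circle.coe_mul, ← Circle.coe_mul, addChar_sectionDefect_add, pathScalar_add_one, mul_inv,
      ← mul_assoc, ← mul_assoc, mul_inv_cancel_left, mul_assoc, mul_assoc]
    exact congrArg (fun z : Circle => (((D.pathScalar x)⁻¹ * z : Circle) : ℂ)) (mul_comm _ _)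
  · rw [mul_zero, zero_mul]

theorem rep_f_integralField (D : GroupConstruction θ K) (b : Fin n) (x : ℤ × ℤ)
    (χ : D.SymmetryDual) : (D.component χ).rep (FTheta.f θ b) (D.integralField x χ) =
      (if b = D.j (QuotientAddGroup.mk x) then (D.β (QuotientAddGroup.mk x) : ℂ) else 0) •
        D.integralField (x + (0, 1)) χ := by
  rw [integralField, integralField, map_smul, rep_f_xi, component, quotientBy_j_mk, smul_smul,
    smul_smul]
  refine congrArg₂ _ ?_ rfl
  split_ifs
  · rw [← Circle.coe_mul, ← Circle.coe_mul, addChar_sectionDefect_add, pathScalar_add_two, mul_inv,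
      ← mul_assoc, ← mul_assoc, mul_inv_cancel_left, mul_assoc, mul_assoc]
    exact congrArg (fun z : Circle => (((D.pathScalar x)⁻¹ * z : Circle) : ℂ)) (mul_comm _ _)
  · rw [mul_zero, zero_mul]

instance (D : GroupConstruction θ K) : BorelSpace D.SymmetryDual := ⟨rfl⟩

theorem continuous_component_character (D : GroupConstruction θ K) (l : D.symmetryLift) :
    Continuous fun χ : D.SymmetryDual => (D.extendedCharacter * D.inflate χ) l :=
  continuous_const.mul (PontryaginDual.continuous_eval _)

instance (L : AddSubgroup (ℤ × ℤ)) : Countable ((ℤ × ℤ) ⧸ L) :=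
  QuotientAddGroup.mk_surjective.countable

/-- Every `σ_χ(w)` maps `ξ_y` to a multiple of one and the same basis vector, with a coefficient
that depends continuously on `χ`. -/
theorem exists_continuous_component_apply_xi (D : GroupConstruction θ K) (w : FTheta θ)
    (y : (ℤ × ℤ) ⧸ D.symmetryLift) : ∃ (c : D.SymmetryDual → ℂ) (z : (ℤ × ℤ) ⧸ D.symmetryLift),
      Continuous c ∧ ∀ χ, (D.component χ).rep w (xi y) = c χ • xi z := by
  induction w using FTheta.induction generalizing y with
  | one => exact ⟨fun _ => 1, y, continuous_const, fun χ => by rw [map_one, one_smul]; rfl⟩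
  | e a =>
    refine ⟨_, _, ?_, fun χ => (D.component χ).rep_e_xi a y⟩
    -- The labels of the components do not involve `χ`; writing the condition with `component 1`
    -- makes it constant.
    change Continuous fun χ =>
      if a = (D.component 1).i y then ((D.component χ).α y : ℂ) else 0
    split_ifs
    swap
    · exact continuous_const
    exact continuous_subtype_val.comp (D.continuous_component_character _)
  | f b =>
    refine ⟨_, _, ?_, fun χ => (D.component χ).rep_f_xi b y⟩
    change Continuous fun χ =>
      if b = (D.component 1).j y then ((D.component χ).β y : ℂ) else 0
    split_ifs
    swap
    · exact continuous_const
    exact continuous_subtype_val.comp (D.continuous_component_character _)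
  | mul v w hv hw =>
    obtain ⟨c, z, hc, h⟩ := hw y
    obtain ⟨c', z', hc', h'⟩ := hv z
    refine ⟨fun χ => c χ * c' χ, z', hc.mul hc', fun χ => ?_⟩
    rw [map_mul, mul_apply_eq_comp, h, map_smul, h', smul_smul]

theorem stronglyMeasurable_component (D : GroupConstruction θ K) (w : FTheta θ)
    (v : EllTwo ((ℤ × ℤ) ⧸ D.symmetryLift)) :
    StronglyMeasurable fun χ => (D.component χ).rep w v := by
  refine stronglyMeasurable_of_span (fun χ => (D.component χ).rep w) topologicalClosure_span_xi
    ?_ v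
  rintro _ ⟨y, rfl⟩
  obtain ⟨c, z, hc, h⟩ := D.exists_continuous_component_apply_xi w y
  simp only [h]
  exact hc.stronglyMeasurable.smul_const _

theorem isDirectIntegralRep (D : GroupConstruction θ K) (μ : Measure D.SymmetryDual)
    [IsProbabilityMeasure μ] [μ.IsMulLeftInvariant] [μ.WeaklyRegular] :
    IsDirectIntegralRep μ D.rep (fun χ => (D.component χ).rep) := by
  refine ⟨D.stronglyMeasurable_component, ?_⟩
  let κ : (ℤ × ℤ) ⧸ K → Circle := fun g => D.gaugeScalar (quotientSection K g)
  let U : EllTwo ((ℤ × ℤ) ⧸ K) ≃ₗᵢ[ℂ] Lp (EllTwo ((ℤ × ℤ) ⧸ D.symmetryLift)) 2 μ :=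
    (PontryaginDual.vectorFieldBasis μ κ D.toQuotient D.symmetryCoord
      D.bijective_coordinates).repr.symm
  have hU : ∀ x : ℤ × ℤ, U (xi (QuotientAddGroup.mk x)) =ᵐ[μ] D.integralField x := by
    intro x
    have h : U (xi (QuotientAddGroup.mk x)) =
        PontryaginDual.vectorFieldLp κ D.toQuotient D.symmetryCoord μ (QuotientAddGroup.mk x) :=
      PontryaginDual.vectorFieldBasis_repr_symm_xi μ κ D.toQuotient D.symmetryCoord
        D.bijective_coordinates _
    rw [h]
    filter_upwards [PontryaginDual.coeFn_vectorFieldLp κ D.toQuotient D.symmetryCoord μ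
      (QuotientAddGroup.mk x)] with χ hχ
    rw [hχ, vectorField_mk]
  -- Since `c x` does not depend on `χ`, the fibrewise identity on basis fields becomes an identity
  -- in `L²`, which extends from the basis to all vectors.
  have hgen : ∀ (w : FTheta θ) (e : ℤ × ℤ) (c : ℤ × ℤ → ℂ),
      (∀ x, D.rep w (xi (QuotientAddGroup.mk x)) = c x • xi (QuotientAddGroup.mk (x + e))) →
      (∀ x χ, (D.component χ).rep w (D.integralField x χ) = c x • D.integralField (x + e) χ) →
      ∀ v, ∀ᵐ χ ∂μ, U (D.rep w v) χ = (D.component χ).rep w (U v χ) := by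
    intro w e c h h'
    refine ae_eq_apply_of_span (U.toContinuousLinearEquiv.toContinuousLinearMap.comp (D.rep w))
      U.toContinuousLinearEquiv.toContinuousLinearMap (fun χ => (D.component χ).rep w)
      topologicalClosure_span_xi ?_
    rintro _ ⟨g, rfl⟩
    obtain ⟨x, rfl⟩ := QuotientAddGroup.mk_surjective g
    have hx : U (D.rep w (xi (QuotientAddGroup.mk x))) =
        c x • U (xi (QuotientAddGroup.mk (x + e))) := by rw [h, map_smul]
    filter_upwards [hU x, hU (x + e),
      Lp.coeFn_smul (c x) (U (xi (QuotientAddGroup.mk (x + e))))] with χ h1 h2 h3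
    change U (D.rep w (xi (QuotientAddGroup.mk x))) χ =
      (D.component χ).rep w (U (xi (QuotientAddGroup.mk x)) χ)
    rw [hx, h3, Pi.smul_apply, h1, h2, h']
  refine ⟨U, fun w => ?_⟩
  induction w using FTheta.induction with
  | one => exact fun v => .of_forall fun χ => by simp only [map_one]; rfl
  | e a =>
    exact hgen _ (1, 0) _ (fun x => D.rep_e_xi a _) (fun x χ => D.rep_e_integralField a x χ)
  | f b =>
    exact hgen _ (0, 1) _ (fun x => D.rep_f_xi b _) (fun x χ => D.rep_f_integralField b x χ)
  | mul v w hv hw =>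
    intro x
    filter_upwards [hw x, hv (D.rep w x)] with χ h h'
    rw [map_mul, map_mul, mul_apply_eq_comp, mul_apply_eq_comp, h', h]

/-- The normalised Haar measure of the dual of the symmetry group. -/
def dualHaar (D : GroupConstruction θ K) : Measure D.SymmetryDual :=
  -- The dual of a discrete group is compact, so the whole space can be the reference set of mass
  -- one.
  Measure.haarMeasure ⊤

instance (D : GroupConstruction θ K) : D.dualHaar.IsHaarMeasure :=
  Measure.isHaarMeasure_haarMeasure _

instance (D : GroupConstruction θ K) : D.dualHaar.Regular :=
  Measure.regular_haarMeasure

instance (D : GroupConstruction θ K) : IsProbabilityMeasure D.dualHaar :=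
  ⟨Measure.haarMeasure_self⟩

theorem finite_symmetryDual (D : GroupConstruction θ K) [Finite D.symmetryGroup] :
    Finite D.SymmetryDual := by
  have : Finite (Multiplicative D.symmetryGroup) := inferInstanceAs (Finite D.symmetryGroup)
  infer_instance

/-- The direct integral exists for every `H`. If `H` is finite, its dual is finite and discrete, and
Haar measure gives each point positive mass. -/
theorem isDirectSumRep (D : GroupConstruction θ K) [Finite D.symmetryGroup] :
    IsDirectSumRep D.rep (fun χ => (D.component χ).rep) := by
  have := D.finite_symmetryDual
  refine (D.isDirectIntegralRep D.dualHaar).isDirectSumRep fun χ => ?_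
  exact (isOpen_discrete {χ}).measure_ne_zero _ (Set.singleton_nonempty χ)

end GroupConstruction

end

theorem theoremT {m n : ℕ} (θ : Equiv.Perm (Fin m × Fin n)) (K : AddSubgroup (ℤ × ℤ))
    (D : GroupConstruction θ K) :
    ∃ S : D.SymmetryDual → GroupConstruction θ D.symmetryLift,
      -- each `σ_χ` is an irreducible atomic representation on `ℓ²(G / H)`
      (∀ χ, IsIrreducibleRep (S χ).rep ∧ IsAtomicRep (S χ).rep) ∧
      -- all the `σ_χ` have the same graph, with the labels induced by those of `σ`
      (∀ χ (x : ℤ × ℤ), (S χ).i (QuotientAddGroup.mk x) = D.i (QuotientAddGroup.mk x) ∧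
        (S χ).j (QuotientAddGroup.mk x) = D.j (QuotientAddGroup.mk x)) ∧
      (∀ χ χ', atomicGraph (S χ).rep = atomicGraph (S χ').rep) ∧
      -- the characters of the `σ_χ` are all the extensions of `ψ` from `K` to `L = HK`
      Set.BijOn (fun χ => (S χ).character) Set.univ
        {ψ' : AddChar D.symmetryLift Circle |
          ∀ k : K, ψ' (AddSubgroup.inclusion D.le_symmetryLift k) = D.character k} ∧
      (∀ χ l, (S χ).character l =
        (S 1).character l * χ (Multiplicative.ofAdd (D.toSymmetry l))) ∧
      -- the direct sum decomposition
      (Finite D.symmetryGroup →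
        Finite D.SymmetryDual ∧ IsDirectSumRep D.rep (fun χ => (S χ).rep)) ∧
      -- the direct integral decomposition
      (Infinite D.symmetryGroup →
        ∃ μ : MeasureTheory.Measure D.SymmetryDual, μ.IsHaarMeasure ∧
          MeasureTheory.IsProbabilityMeasure μ ∧
          IsDirectIntegralRep μ D.rep (fun χ => (S χ).rep)) := by
  refine ⟨D.component, fun χ => ⟨?_, (D.component χ).isAtomicRep⟩, fun χ x => ⟨?_, ?_⟩,
    fun χ χ' => GroupConstruction.atomicGraph_congr rfl rfl, D.bijOn_component_character,
    D.component_character_eq, fun _ => ⟨D.finite_symmetryDual, D.isDirectSumRep⟩,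
    fun _ => ⟨D.dualHaar, inferInstance, inferInstance, D.isDirectIntegralRep _⟩⟩
  · exact (D.component χ).isIrreducibleRep (D.quotientBy_symmetryGroup _)
  · exact D.quotientBy_i_mk _ x
  · exact D.quotientBy_j_mk _ x
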